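/- Let $X$ be a compact metric space with Borel $\sigma$-algebra $\mathcal B_X$, let $T$ be an action of the additive group $\mathbb Z^2$ on $X$ by homeomorphisms $T^{(m,n)}$, and let $\mu$ be a $T$-invariant Borel probability measure. Let $\vec v=(1,\beta)$ with $\beta\in\mathbb R$. For $b>0$ put $$\Lambda^{\vec v}(b)=\{(m,n)\in\mathbb Z^2:\ \beta m-b/2\le n\le \beta m+b/2\}.$$ Let $U_T^{(m,n)}f=f\circ T^{(m,n)}$ on $L^2(X,\mathcal B_X,\mu)$. Fix $b_0>0$ (arbitrary) and let $$\mathcal K_\mu^{\vec v}=\bigl\{B\in\mathcal B_X:\ \overline{\{U_T^{(m,n)}1_B:(m,n)\in\Lambda^{\vec v}(b_0)\}}\text{ is compact in }L^2(X,\mathcal B_X,\mu)\bigr\}.$$ The system $(X,\mathcal B_X,\mu,T)$ is called $\vec v$-weak mixing if $\mathcal K_\mu^{\vec v}=\{X,\emptyset\}$ up to null sets, i.e. every $B\in\mathcal K_\mu^{\vec v}$ has $\mu(B)\in\{0,1\}$. For a finite measurable partition $\alpha$ of $X$ let $H_\mu(\alpha)=-\sum_{A\in\alpha}\mu(A)\log\mu(A)$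 (with $0\log 0=0$), and for a sequence $S=\{(m_i,n_i)\}_{i=1}^\infty$ in $\mathbb Z^2$ let $$h^S_\mu(T,\alpha)=\limsup_{k\to\infty}\frac1k H_\mu\Bigl(\bigvee_{i=1}^k T^{-(m_i,n_i)}\alpha\Bigr).$$ **Theorem.** For every $b\in(0,\infty)$ (independently of $b_0$) the following are equivalent. (a) $(X,\mathcal B_X,\mu,T)$ is $\vec v$-weak mixing. (b) There is an infinite sequence $S=\{(m_i,n_i)\}_{i=1}^\infty$ of elements of $\Lambda^{\vec v}(b)$, with $\{m_i\}_{i=1}^\infty$ strictly monotone, such that $h^S_\mu(T,\alpha)=H_\mu(\alpha)$ for every finite measurable partition $\alpha$ of $X$. -/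

import Mathlib

open MeasureTheory Filter

noncomputable section

namespace DirectionalWeakMixing

/-- The strip `{(m, n) ∈ ℤ² : β m - b / 2 ≤ n ≤ β m + b / 2}` of width `b` around the line in
direction `(1, β)`. -/
def strip (β b : ℝ) : Set (ℤ × ℤ) :=
  {g | β * (g.1 : ℝ) - b / 2 ≤ (g.2 : ℝ) ∧ (g.2 : ℝ) ≤ β * (g.1 : ℝ) + b / 2}

/-- An infinite sequence of elements of the strip whose first coordinates are strictly monotone
(strictly increasing or strictly decreasing). -/
def IsStripSequence (β b : ℝ) (S : ℕ → ℤ × ℤ) : Prop :=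
  (∀ i, S i ∈ strip β b) ∧
    (StrictMono (fun i => (S i).1) ∨ StrictAnti (fun i => (S i).1))

/-- A measurable partition of `X` with cells indexed by `ι`. Empty cells are allowed; they do not
change the entropy, because `0 log 0 = 0`. -/
structure MeasurablePartition (ι X : Type*) [MeasurableSpace X] where
  cell : ι → Set X
  measurableSet_cell : ∀ i, MeasurableSet (cell i)
  disjoint_cell : ∀ i j, i ≠ j → Disjoint (cell i) (cell j)
  iUnion_cell : ⋃ i, cell i = Set.univ

namespace MeasurablePartition

variable {ι J X : Type*} [MeasurableSpace X]

/-- The partition into the sets `f⁻¹ A`, for `A` a cell of `α`. -/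
def comap (α : MeasurablePartition ι X) (f : X → X) (hf : Measurable f) :
    MeasurablePartition ι X where
  cell i := f ⁻¹' α.cell i
  measurableSet_cell i := hf (α.measurableSet_cell i)
  disjoint_cell i j hij := (α.disjoint_cell i j hij).preimage f
  iUnion_cell := by rw [← Set.preimage_iUnion, α.iUnion_cell, Set.preimage_univ]

/-- The join `⋁ⱼ αⱼ` of finitely many partitions: its cells are the intersections `⋂ⱼ Aⱼ` with
`Aⱼ` a cell of `αⱼ`. -/
def join [Finite J] (α : J → MeasurablePartition ι X) : MeasurablePartition (J → ι) X where
  cell w := ⋂ j, (α j).cell (w j)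
  measurableSet_cell w := MeasurableSet.iInter fun j => (α j).measurableSet_cell (w j)
  disjoint_cell w w' h := by
    obtain ⟨j, hj⟩ := Function.ne_iff.mp h
    exact ((α j).disjoint_cell _ _ hj).mono (Set.iInter_subset _ j) (Set.iInter_subset _ j)
  iUnion_cell := by
    refine Set.eq_univ_of_forall fun x => ?_
    have hx : ∀ j, ∃ i, x ∈ (α j).cell i := fun j => by
      have := Set.mem_univ x
      rwa [← (α j).iUnion_cell, Set.mem_iUnion] at this
    choose w hw using hx
    exact Set.mem_iUnion.mpr ⟨w, Set.mem_iInter.mpr hw⟩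

/-- The entropy `H_μ(α) = -∑_{A ∈ α} μ(A) log μ(A)` of a finite measurable partition. -/
def entropy [Fintype ι] (μ : Measure X) (α : MeasurablePartition ι X) : ℝ :=
  ∑ i, Real.negMulLog (μ.real (α.cell i))

end MeasurablePartition

section System

variable {X : Type*} [MeasurableSpace X] [AddAction (ℤ × ℤ) X] [MeasurableConstVAdd (ℤ × ℤ) X]

/-- `⋁ᵢ T^{-(mᵢ, nᵢ)} α` over the first `k` terms of the sequence `S`, where `T^g x = g +ᵥ x`. -/
def sequenceJoin {ι : Type*} (α : MeasurablePartition ι X) (S : ℕ → ℤ × ℤ) (k : ℕ) :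
    MeasurablePartition (Fin k → ι) X :=
  MeasurablePartition.join fun i : Fin k =>
    α.comap (fun x => S i +ᵥ x) (measurable_const_vadd (S i))

/-- The sequence entropy `h^S_μ(T, α) = limsup_k (1 / k) H_μ(⋁_{i ≤ k} T^{-(mᵢ, nᵢ)} α)`,
with the upper limit taken in the extended reals. -/
def sequenceEntropy {ι : Type*} [Fintype ι] (μ : Measure X) (α : MeasurablePartition ι X)
    (S : ℕ → ℤ × ℤ) : EReal :=
  limsup (fun k : ℕ => (((sequenceJoin α S k).entropy μ / (k : ℝ) : ℝ) : EReal)) atTop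

/-- The Koopman operator `U_T^g f = f ∘ T^g` on `L²(X, μ)`. -/
def koopman (μ : Measure X) [VAddInvariantMeasure (ℤ × ℤ) X μ] (g : ℤ × ℤ) :
    Lp ℂ 2 μ →ₗᵢ[ℂ] Lp ℂ 2 μ :=
  Lp.compMeasurePreservingₗᵢ ℂ (fun x => g +ᵥ x) (measurePreserving_vadd g μ)

/-- The directional Kronecker algebra in direction `(1, β)`, defined with the strip of width `b`:
the measurable sets `B` for which the closure of `{U_T^g 1_B : g ∈ strip β b}` is compact
in `L²(X, μ)`. -/
def kroneckerAlgebra (μ : Measure X) [IsFiniteMeasure μ] [VAddInvariantMeasure (ℤ × ℤ) X μ]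
    (β b : ℝ) : Set (Set X) :=
  {B | ∃ hB : MeasurableSet B, IsCompact (closure
    ((fun g => koopman μ g (indicatorConstLp 2 hB (measure_ne_top μ B) (1 : ℂ))) '' strip β b))}

/-- Weak mixing in direction `(1, β)`: the directional Kronecker algebra, defined with the strip of
width `b`, is trivial, that is, it is `{X, ∅}` up to sets of measure zero. -/
def IsWeakMixing (μ : Measure X) [IsFiniteMeasure μ] [VAddInvariantMeasure (ℤ × ℤ) X μ]
    (β b : ℝ) : Prop :=
  ∀ B ∈ kroneckerAlgebra μ β b, B =ᵐ[μ] (∅ : Set X) ∨ B =ᵐ[μ] (Set.univ : Set X)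

end System

end DirectionalWeakMixing

end

/-!
(b ⇒ a) A strip is covered by finitely many translates of any other strip, so the widths play no
role. If the translates of `1_B` over a strip are precompact, then up to a small conditional
entropy each translate of `{B, Bᶜ}` along `S` is one of finitely many fixed ones. So the sequence
entropy of `{B, Bᶜ}` is `0`, and if it equals `H(B, Bᶜ)` then `B` is null or conull.

(a ⇒ b) For a set `A`, average the rank one operators `x ↦ ⟪U^g 1_A, x⟫ U^g 1_A` over the lattice
points `g` near the line of direction `(1, β)` at offset `w`, with tent weights across the line and
a shift-invariant mean along it. The result `T_w` is Hilbert–Schmidt and Lipschitz in `w`, and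
conjugation by `U^g` only changes the offset. Hence the orbit of `T_w h` along a strip is
precompact, and by weak mixing, applied to its level sets, `T_w h` is constant. For
`h = 1_C - μ(C)` this forces `⟪T_w h, h⟫ = 0`: the mean of `|⟪U^g 1_A, h⟫|²` vanishes, that is,
`μ(T^{-g} A ∩ C) → μ(A) μ(C)` along a filter on the strip. Choosing `S` inductively along that
filter makes each new translate of every member of a countable dense family of partitions
asymptotically independent of the previous ones, which gives these partitions full sequence
entropy. All others are approximated by them in conditional entropy.
-/

noncomputable section

namespace DirectionalWeakMixing

open scoped InnerProductSpace
open Topology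

section NegMulLog

open Real Finset

lemma negMulLog_add_le {a b : ℝ} (ha : 0 ≤ a) (hb : 0 ≤ b) :
    negMulLog (a + b) ≤ negMulLog a + negMulLog b := by
  rcases ha.eq_or_lt with rfl | ha
  · simp
  rcases hb.eq_or_lt with rfl | hb
  · simp
  have log_a := log_le_log ha (le_add_of_nonneg_right hb.le)
  have log_b := log_le_log hb (le_add_of_nonneg_left ha.le)
  simp only [negMulLog]
  nlinarith

lemma negMulLog_sum_le {ι : Type*} (s : Finset ι) {p : ι → ℝ} (hp : ∀ i ∈ s, 0 ≤ p i) :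
    negMulLog (∑ i ∈ s, p i) ≤ ∑ i ∈ s, negMulLog (p i) :=
  le_sum_of_subadditive_on_pred negMulLog (0 ≤ ·) negMulLog_zero.le
    (fun _ _ => negMulLog_add_le) (fun _ _ => add_nonneg) p hp

/-- This is `log t ≤ t - 1` at `t = a b / (q s)`. -/
lemma negMulLog_add_mul_log_le {q a b s : ℝ} (hq : 0 ≤ q) (hqa : q ≤ a) (hqb : q ≤ b)
    (has : a ≤ s) :
    negMulLog q - q * log s + q * log a + q * log b ≤ a * b / s - q := by
  rcases hq.eq_or_lt with rfl | hq
  · simpa using div_nonneg (mul_nonneg hqa hqb) (hqa.trans has)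
  have ha := hq.trans_le hqa
  have hb := hq.trans_le hqb
  have hs := ha.trans_le has
  have hlog := log_le_sub_one_of_pos (x := a * b / (q * s)) (by positivity)
  rw [log_div (by positivity) (by positivity), log_mul ha.ne' hb.ne',
    log_mul hq.ne' hs.ne'] at hlog
  calc negMulLog q - q * log s + q * log a + q * log b
      = q * (log a + log b - (log q + log s)) := by rw [negMulLog]; ring
    _ ≤ q * (a * b / (q * s) - 1) := by gcongr
    _ = a * b / s - q := by field_simp

lemma sum_negMulLog_add_le {ι κ : Type*} [Fintype ι] [Fintype κ] {Q : ι → κ → ℝ}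
    (hQ : ∀ x y, 0 ≤ Q x y) :
    ∑ x, ∑ y, negMulLog (Q x y) + negMulLog (∑ x, ∑ y, Q x y) ≤
      ∑ x, negMulLog (∑ y, Q x y) + ∑ y, negMulLog (∑ x, Q x y) := by
  set s := ∑ x, ∑ y, Q x y with hs
  set a : ι → ℝ := fun x => ∑ y, Q x y with ha
  set b : κ → ℝ := fun y => ∑ x, Q x y with hb
  have hsb : ∑ y, b y = s := sum_comm
  have ha0 : ∀ x, 0 ≤ a x := fun x => sum_nonneg fun y _ => hQ x y
  have key := sum_le_sum fun x (_ : x ∈ univ) => sum_le_sum fun y (_ : y ∈ univ) =>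
    negMulLog_add_mul_log_le (hQ x y)
      (single_le_sum (f := Q x) (fun y _ => hQ x y) (mem_univ y))
      (single_le_sum (f := (Q · y)) (fun x _ => hQ x y) (mem_univ x))
      (single_le_sum (f := a) (fun x _ => ha0 x) (mem_univ x))
  simp only [sum_add_distrib, sum_sub_distrib] at key
  have sum_ratio : ∑ x, ∑ y, a x * b y / s = s := by
    simp_rw [← sum_div, ← mul_sum, hsb, ← sum_mul]
    exact mul_self_div_self s
  have sum_log_s : ∑ x, ∑ y, Q x y * log s = - negMulLog s := by
    simp only [← sum_mul, negMulLog, neg_mul, neg_neg]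
    rfl
  have sum_log_a : ∑ x, ∑ y, Q x y * log (a x) = - ∑ x, negMulLog (a x) := by
    simp only [← sum_mul, negMulLog, neg_mul, sum_neg_distrib, neg_neg, ha]
  have sum_log_b : ∑ x, ∑ y, Q x y * log (b y) = - ∑ y, negMulLog (b y) := by
    rw [sum_comm]
    simp only [← sum_mul, negMulLog, neg_mul, sum_neg_distrib, neg_neg, hb]
  rw [sum_ratio, sum_log_s, sum_log_a, sum_log_b] at key
  linarith

end NegMulLog

section Itinerary

variable {X ι : Type*}

/-- The map whose level sets form the join of the partitions into level sets of `Y 0`, …,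
`Y (k - 1)`. -/
def itinerary (Y : ℕ → X → ι) (k : ℕ) : X → Fin k → ι :=
  fun x j => Y j x

lemma itinerary_succ (Y : ℕ → X → ι) (k : ℕ) :
    itinerary Y (k + 1) = fun x => Fin.snocEquiv (fun _ => ι) (Y k x, itinerary Y k x) := by
  funext x j
  refine Fin.lastCases ?_ (fun j => ?_) j <;> simp [itinerary]

lemma measurable_itinerary [MeasurableSpace X] [MeasurableSpace ι] {Y : ℕ → X → ι}
    (hY : ∀ j, Measurable (Y j)) (k : ℕ) : Measurable (itinerary Y k) :=
  measurable_pi_lambda _ fun j => hY j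

end Itinerary

section Entropy

open Real Finset

variable {X X' ι κ ι' κ' τ : Type*} [MeasurableSpace X] [MeasurableSpace X']
  [Fintype ι] [Fintype κ] [Fintype ι'] [Fintype κ'] [Fintype τ] (μ : Measure X)

/-- The entropy of the partition of `X` into the level sets of a map with finitely many values. -/
def entropy (Y : X → ι) : ℝ :=
  ∑ i, negMulLog (μ.real (Y ⁻¹' {i}))

/-- The conditional entropy `H(Y | Z) = H(Y, Z) - H(Z)` of two maps with finitely many values. -/
def condEntropy (Y : X → ι) (Z : X → κ) : ℝ :=
  entropy μ (fun x => (Y x, Z x)) - entropy μ Z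

lemma entropy_nonneg [IsProbabilityMeasure μ] (Y : X → ι) : 0 ≤ entropy μ Y :=
  sum_nonneg fun _ _ => negMulLog_nonneg measureReal_nonneg measureReal_le_one

lemma entropy_le_card (Y : X → ι) : entropy μ Y ≤ Fintype.card ι := by
  have := sum_le_card_nsmul univ (fun i => negMulLog (μ.real (Y ⁻¹' {i}))) 1 fun i _ =>
    (negMulLog_le_one_sub_self measureReal_nonneg).trans (sub_le_self _ measureReal_nonneg)
  simpa [entropy] using this

lemma entropy_of_subsingleton [Subsingleton ι] [IsProbabilityMeasure μ] (Y : X → ι) :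
    entropy μ Y = 0 := by
  refine sum_eq_zero fun i _ => ?_
  have : Y ⁻¹' {i} = Set.univ := Set.eq_univ_of_forall fun x => Subsingleton.elim (Y x) i
  simp [this]

lemma entropy_equiv_comp (e : ι ≃ κ) (Y : X → ι) :
    entropy μ (fun x => e (Y x)) = entropy μ Y := by
  rw [entropy, ← e.sum_comp]
  refine sum_congr rfl fun i _ => congrArg (fun s => negMulLog (μ.real s)) ?_
  ext x
  simp

lemma condEntropy_equiv_comp (e : ι ≃ ι') (f : κ ≃ κ') (Y : X → ι) (Z : X → κ) :
    condEntropy μ (fun x => e (Y x)) (fun x => f (Z x)) = condEntropy μ Y Z := by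
  rw [condEntropy, entropy_equiv_comp μ f, condEntropy,
    ← entropy_equiv_comp μ (e.prodCongr f) (fun x => (Y x, Z x))]
  rfl

lemma entropy_prodMk (Y : X → ι) (Z : X → κ) :
    entropy μ (fun x => (Y x, Z x)) =
      ∑ i, ∑ k, negMulLog (μ.real (Y ⁻¹' {i} ∩ Z ⁻¹' {k})) := by
  simp_rw [entropy, Fintype.sum_prod_type, ← Set.singleton_prod_singleton, Set.mk_preimage_prod]

lemma entropy_itinerary_succ (Y : ℕ → X → ι) (k : ℕ) :
    entropy μ (itinerary Y (k + 1)) = entropy μ (fun x => (Y k x, itinerary Y k x)) := by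
  rw [itinerary_succ, entropy_equiv_comp]

lemma condEntropy_itinerary_succ (Y : ℕ → X → ι) (Z : ℕ → X → κ) (k : ℕ) :
    condEntropy μ (itinerary Y (k + 1)) (itinerary Z (k + 1)) =
      condEntropy μ (fun x => (Y k x, itinerary Y k x)) (fun x => (Z k x, itinerary Z k x)) := by
  rw [itinerary_succ, itinerary_succ, condEntropy_equiv_comp]

variable [MeasurableSpace ι] [MeasurableSingletonClass ι]

lemma entropy_comp_le [IsFiniteMeasure μ] {Y : X → ι} (hY : Measurable Y) (f : ι → κ) :
    entropy μ (fun x => f (Y x)) ≤ entropy μ Y := by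
  classical
  have fiber : ∀ k, μ.real ((fun x => f (Y x)) ⁻¹' {k}) = ∑ i with f i = k, μ.real (Y ⁻¹' {i}) := by
    intro k
    rw [sum_measureReal_preimage_singleton _ fun i _ => hY (measurableSet_singleton i)]
    congr 1
    ext x
    simp
  rw [entropy, entropy, ← sum_fiberwise univ f]
  refine sum_le_sum fun k _ => ?_
  rw [fiber]
  exact negMulLog_sum_le _ fun i _ => measureReal_nonneg

variable [MeasurableSpace κ] [MeasurableSingletonClass κ] [MeasurableSpace ι']
  [MeasurableSingletonClass ι'] [MeasurableSpace κ'] [MeasurableSingletonClass κ']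

variable {μ}

lemma entropy_comp_measurePreserving {ν : Measure X'} {Y : X' → ι} (hY : Measurable Y)
    {f : X → X'} (hf : MeasurePreserving f μ ν) :
    entropy μ (fun x => Y (f x)) = entropy ν Y :=
  sum_congr rfl fun i _ => congrArg _
    (hf.measureReal_preimage (hY (measurableSet_singleton i)).nullMeasurableSet)

lemma condEntropy_comp_measurePreserving {ν : Measure X'} {Y : X' → ι} {Z : X' → κ}
    (hY : Measurable Y) (hZ : Measurable Z) {f : X → X'} (hf : MeasurePreserving f μ ν) :
    condEntropy μ (fun x => Y (f x)) (fun x => Z (f x)) = condEntropy ν Y Z := by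
  rw [condEntropy, entropy_comp_measurePreserving hZ hf,
    entropy_comp_measurePreserving (hY.prodMk hZ) hf, condEntropy]

variable (μ) [IsFiniteMeasure μ]

lemma sum_measureReal_inter_preimage {Y : X → ι} (hY : Measurable Y) (A : Set X) :
    ∑ i, μ.real (A ∩ Y ⁻¹' {i}) = μ.real A := by
  have h := sum_measureReal_preimage_singleton (μ := μ.restrict A) univ
    fun i _ => hY (measurableSet_singleton i)
  simpa [measureReal_restrict_apply (hY (measurableSet_singleton _)), Set.inter_comm] using h

lemma entropy_submodular {Y : X → ι} {Z : X → κ} (hY : Measurable Y) (hZ : Measurable Z)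
    (W : X → τ) :
    entropy μ (fun x => (Y x, Z x, W x)) + entropy μ W ≤
      entropy μ (fun x => (Y x, W x)) + entropy μ (fun x => (Z x, W x)) := by
  set P : τ → ι → κ → ℝ := fun t i k => μ.real (W ⁻¹' {t} ∩ Y ⁻¹' {i} ∩ Z ⁻¹' {k})
  have sum_Z : ∀ t i, ∑ k, P t i k = μ.real (W ⁻¹' {t} ∩ Y ⁻¹' {i}) := fun t i =>
    sum_measureReal_inter_preimage μ hZ _
  have sum_Y : ∀ t k, ∑ i, P t i k = μ.real (W ⁻¹' {t} ∩ Z ⁻¹' {k}) := fun t k => by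
    simp only [P, Set.inter_right_comm _ _ (Z ⁻¹' {k})]
    exact sum_measureReal_inter_preimage μ hY _
  have sum_YZ : ∀ t, ∑ i, ∑ k, P t i k = μ.real (W ⁻¹' {t}) := fun t => by
    simp only [sum_Z, sum_measureReal_inter_preimage μ hY]
  have entropy_W : entropy μ W = ∑ t, negMulLog (∑ i, ∑ k, P t i k) := by
    simp only [sum_YZ, entropy]
  have entropy_YW : entropy μ (fun x => (Y x, W x)) = ∑ t, ∑ i, negMulLog (∑ k, P t i k) := by
    simp only [sum_Z, entropy_prodMk]
    simp only [Set.inter_comm, sum_comm (s := (univ : Finset τ))]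
  have entropy_ZW : entropy μ (fun x => (Z x, W x)) = ∑ t, ∑ k, negMulLog (∑ i, P t i k) := by
    simp only [sum_Y, entropy_prodMk]
    simp only [Set.inter_comm, sum_comm (s := (univ : Finset τ))]
  have entropy_YZW :
      entropy μ (fun x => (Y x, Z x, W x)) = ∑ t, ∑ i, ∑ k, negMulLog (P t i k) := by
    rw [← entropy_equiv_comp μ ((Equiv.prodAssoc ι κ τ).symm.trans (Equiv.prodComm _ τ))]
    simp only [Equiv.trans_apply, Equiv.prodAssoc_symm_apply, Equiv.prodComm_apply,
      Prod.swap_prod_mk, entropy_prodMk, Fintype.sum_prod_type, ← Set.singleton_prod_singleton,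
      Set.mk_preimage_prod, Set.inter_assoc, P]
  rw [entropy_YZW, entropy_W, entropy_YW, entropy_ZW, ← sum_add_distrib, ← sum_add_distrib]
  exact sum_le_sum fun t _ => sum_negMulLog_add_le fun _ _ => measureReal_nonneg

lemma entropy_le_add_condEntropy {Y : X → ι} {Z : X → κ} (hY : Measurable Y)
    (hZ : Measurable Z) : entropy μ Y ≤ entropy μ Z + condEntropy μ Y Z := by
  have := entropy_comp_le μ (hY.prodMk hZ) Prod.fst
  rwa [condEntropy, add_sub_cancel]

lemma condEntropy_prodMk_le {Y : X → ι} {Z : X → κ} {Y' : X → ι'} {Z' : X → κ'}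
    (hY : Measurable Y) (hZ : Measurable Z) (hY' : Measurable Y') (hZ' : Measurable Z') :
    condEntropy μ (fun x => (Y x, Y' x)) (fun x => (Z x, Z' x)) ≤
      condEntropy μ Y Z + condEntropy μ Y' Z' := by
  have split := entropy_submodular μ hY hY' fun x => (Z x, Z' x)
  have drop_Z' := entropy_submodular μ hY hZ' Z
  have drop_Z := entropy_submodular μ hY' hZ Z'
  have swap := entropy_equiv_comp μ (Equiv.prodComm κ κ') fun x => (Z x, Z' x)
  have swap_right := entropy_equiv_comp μ ((Equiv.refl ι).prodCongr (Equiv.prodComm κ κ'))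
    fun x => (Y x, Z x, Z' x)
  have assoc := entropy_equiv_comp μ (Equiv.prodAssoc ι ι' (κ × κ'))
    fun x => ((Y x, Y' x), Z x, Z' x)
  simp only [Equiv.prodComm_apply, Prod.swap_prod_mk, Equiv.prodCongr_apply, Equiv.coe_refl,
    Prod.map_apply, id_eq, Equiv.prodAssoc_apply] at swap swap_right assoc
  simp only [condEntropy]
  linarith

lemma condEntropy_itinerary_le {Y : ℕ → X → ι} {Z : ℕ → X → κ}
    (hY : ∀ j, Measurable (Y j)) (hZ : ∀ j, Measurable (Z j)) (k : ℕ) :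
    condEntropy μ (itinerary Y k) (itinerary Z k) ≤
      ∑ j ∈ range k, condEntropy μ (Y j) (Z j) := by
  induction k with
  | zero =>
    rw [condEntropy, ← entropy_equiv_comp μ (Equiv.uniqueProd _ _)]
    simp
  | succ k ih =>
    rw [sum_range_succ, condEntropy_itinerary_succ]
    have := condEntropy_prodMk_le μ (hY k) (hZ k) (measurable_itinerary hY k)
      (measurable_itinerary hZ k)
    linarith

lemma entropy_itinerary_le_add_sum_condEntropy {Y : ℕ → X → ι} {Z : ℕ → X → κ}
    (hY : ∀ j, Measurable (Y j)) (hZ : ∀ j, Measurable (Z j)) (k : ℕ) :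
    entropy μ (itinerary Y k) ≤
      entropy μ (itinerary Z k) + ∑ j ∈ range k, condEntropy μ (Y j) (Z j) :=
  (entropy_le_add_condEntropy μ (measurable_itinerary hY k) (measurable_itinerary hZ k)).trans
    (add_le_add_right (condEntropy_itinerary_le μ hY hZ k) _)

lemma entropy_itinerary_le_sum {μ : Measure X} [IsProbabilityMeasure μ] {Y : ℕ → X → ι}
    (hY : ∀ j, Measurable (Y j)) (k : ℕ) :
    entropy μ (itinerary Y k) ≤ ∑ j ∈ range k, entropy μ (Y j) := by
  have condEntropy_unit : ∀ j, condEntropy μ (Y j) (fun _ => ()) = entropy μ (Y j) := fun j => by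
    rw [condEntropy, entropy_of_subsingleton μ (fun _ => ()), sub_zero]
    exact entropy_equiv_comp μ (Equiv.prodPUnit ι).symm (Y j)
  have := entropy_itinerary_le_add_sum_condEntropy μ (Z := fun _ _ => ()) hY
    (fun _ => measurable_const) k
  simpa [entropy_of_subsingleton, condEntropy_unit] using this

variable (ι) in
lemma exists_condEntropy_lt {ε : ℝ} (hε : 0 < ε) :
    ∃ δ > 0, ∀ Y Z : X → ι, Measurable Y → Measurable Z → μ.real {x | Y x ≠ Z x} < δ →
      condEntropy μ Y Z < ε := by
  obtain ⟨δ, hδ, H⟩ := Metric.uniformContinuousOn_iff.1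
    (isCompact_Icc.uniformContinuousOn_of_continuous
      (continuous_negMulLog.continuousOn (s := Set.Icc 0 (μ.real Set.univ))))
    (ε / (Fintype.card (ι × ι) + 1)) (by positivity)
  refine ⟨δ, hδ, fun Y Z hY hZ hYZ => ?_⟩
  have mem_Icc : ∀ s : Set X, μ.real s ∈ Set.Icc 0 (μ.real Set.univ) := fun s =>
    ⟨measureReal_nonneg, measureReal_mono s.subset_univ⟩
  have close : ∀ p : ι × ι, negMulLog (μ.real ((fun x => (Y x, Z x)) ⁻¹' {p})) -
      negMulLog (μ.real ((fun x => (Z x, Z x)) ⁻¹' {p})) ≤ ε / (Fintype.card (ι × ι) + 1) := by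
    refine fun p => (le_abs_self _).trans (H _ (mem_Icc _) _ (mem_Icc _) ?_).le
    have hp : MeasurableSet {p} := measurableSet_singleton p
    refine ((abs_measureReal_sub_le_measureReal_symmDiff (hY.prodMk hZ hp).nullMeasurableSet
      (hZ.prodMk hZ hp).nullMeasurableSet).trans (measureReal_mono ?_)).trans_lt hYZ
    rintro x hx (hYx : Y x = Z x)
    simp [Set.mem_symmDiff, hYx] at hx
  calc condEntropy μ Y Z
      ≤ entropy μ (fun x => (Y x, Z x)) - entropy μ (fun x => (Z x, Z x)) :=
        sub_le_sub_left (entropy_comp_le μ hZ fun i => (i, i)) _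
    _ ≤ ∑ _p : ι × ι, ε / (Fintype.card (ι × ι) + 1) := by
        rw [entropy, entropy, ← sum_sub_distrib]
        exact sum_le_sum fun p _ => close p
    _ < ε := by
        rw [sum_const, card_univ, nsmul_eq_mul, ← mul_div_assoc, div_lt_iff₀ (by positivity)]
        linarith

end Entropy

section Mean

open Finset

variable {F G : Type*} [NormedAddCommGroup F] [NormedSpace ℝ F] [NormedAddCommGroup G]
  [NormedSpace ℝ G] {a a' : ℤ → F} {C C' : ℝ}

/-- The average of a two-sided sequence over `0 ≤ m < N`, with junk value `0` at `N = 0`. -/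
def avg (a : ℤ → F) (N : ℕ) : F := (N : ℝ)⁻¹ • ∑ m ∈ range N, a m

lemma norm_avg_le_avg {ρ : ℤ → ℝ} (h : ∀ m, ‖a m‖ ≤ ρ m) (N : ℕ) : ‖avg a N‖ ≤ avg ρ N := by
  rw [avg, norm_smul, Real.norm_of_nonneg (by positivity), avg, smul_eq_mul]
  gcongr
  exact norm_sum_le_of_le _ fun m _ => h m

lemma norm_avg_le (h : ∀ m, ‖a m‖ ≤ C) (N : ℕ) : ‖avg a N‖ ≤ C := by
  refine (norm_avg_le_avg h N).trans ?_
  rcases N.eq_zero_or_pos with rfl | hN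
  · simpa [avg] using (norm_nonneg _).trans (h 0)
  · simp [avg, inv_mul_cancel_left₀ (Nat.cast_ne_zero.2 hN.ne' : (N : ℝ) ≠ 0)]

lemma norm_avg_sq_le (a : ℤ → F) (N : ℕ) : ‖avg a N‖ ^ 2 ≤ avg (fun m => ‖a m‖ ^ 2) N := by
  rcases N.eq_zero_or_pos with rfl | hN
  · simp [avg]
  have : (0 : ℝ) < N := Nat.cast_pos.2 hN
  calc ‖avg a N‖ ^ 2 ≤ (avg (fun m => ‖a m‖) N) ^ 2 := by
        gcongr
        exact norm_avg_le_avg (fun _ => le_rfl) N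
    _ = (N : ℝ)⁻¹ ^ 2 * (∑ m ∈ range N, ‖a m‖) ^ 2 := by rw [avg, smul_eq_mul, mul_pow]
    _ ≤ (N : ℝ)⁻¹ ^ 2 * (N * ∑ m ∈ range N, ‖a m‖ ^ 2) := by
        gcongr
        simpa using sq_sum_le_card_mul_sum_sq (s := range N) (f := fun m => ‖a m‖)
    _ = avg (fun m => ‖a m‖ ^ 2) N := by
        rw [avg, smul_eq_mul]
        field_simp

lemma tendsto_avg_shift_one (h : ∀ m, ‖a m‖ ≤ C) :
    Tendsto (fun N => avg (fun m => a (m + 1)) N - avg a N) atTop (𝓝 0) := by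
  refine squeeze_zero_norm (a := fun N : ℕ => 2 * C / (N : ℝ)) (fun N => ?_)
    (tendsto_const_div_atTop_nhds_zero_nat _)
  have telescope : avg (fun m => a (m + 1)) N - avg a N = (N : ℝ)⁻¹ • (a N - a 0) := by
    rw [avg, avg, ← smul_sub, ← sum_sub_distrib]
    exact_mod_cast congrArg _ (sum_range_sub (fun n : ℕ => a n) N)
  rw [telescope, norm_smul, Real.norm_of_nonneg (by positivity), inv_mul_eq_div]
  gcongr
  exact (norm_sub_le _ _).trans (by linarith [h N, h 0])

lemma tendsto_avg_shift (h : ∀ m, ‖a m‖ ≤ C) (k : ℤ) :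
    Tendsto (fun N => avg (fun m => a (m + k)) N - avg a N) atTop (𝓝 0) := by
  induction k using Int.induction_on with
  | zero => simp
  | succ k ih =>
    have := (tendsto_avg_shift_one (a := fun m => a (m + k)) fun m => h _).add ih
    simpa [add_assoc, add_comm, add_left_comm] using this
  | pred k ih =>
    have := ih.sub (tendsto_avg_shift_one (a := fun m => a (m + (-k - 1))) fun m => h _)
    simp only [sub_zero] at this
    refine this.congr fun N => ?_
    have shift : ∀ m : ℤ, m + 1 + (-(k : ℤ) - 1) = m + -k := fun m => by ring
    simp only [shift]
    abel

/-- A shift-invariant mean on bounded two-sided sequences: the limit of the averages along a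
nonprincipal ultrafilter. -/
def mean (a : ℤ → F) : F := limUnder (hyperfilter ℕ : Filter ℕ) (avg a)

lemma mean_eq_of_tendsto {x : F} (h : Tendsto (fun n : ℕ => a n) atTop (𝓝 x)) : mean a = x :=
  (h.cesaro_smul.mono_left Nat.hyperfilter_le_atTop).limUnder_eq

lemma mean_const (x : F) : mean (fun _ => x) = x := mean_eq_of_tendsto tendsto_const_nhds

variable [ProperSpace F]

lemma tendsto_mean (h : ∀ m, ‖a m‖ ≤ C) : Tendsto (avg a) (hyperfilter ℕ) (𝓝 (mean a)) := by
  apply tendsto_nhds_limUnder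
  obtain ⟨z, -, hz⟩ := (isCompact_closedBall (0 : F) C).ultrafilter_le_nhds
    ((hyperfilter ℕ).map (avg a))
    (le_principal_iff.2 (mem_map.2 (univ_mem' fun N => by simpa using norm_avg_le h N)))
  exact ⟨z, hz⟩

lemma mean_add (h : ∀ m, ‖a m‖ ≤ C) (h' : ∀ m, ‖a' m‖ ≤ C') :
    mean (fun m => a m + a' m) = mean a + mean a' :=
  (((tendsto_mean h).add (tendsto_mean h')).congr fun N => by
    simp only [avg, sum_add_distrib, smul_add]).limUnder_eq

lemma mean_sub (h : ∀ m, ‖a m‖ ≤ C) (h' : ∀ m, ‖a' m‖ ≤ C') :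
    mean (fun m => a m - a' m) = mean a - mean a' :=
  (((tendsto_mean h).sub (tendsto_mean h')).congr fun N => by
    simp only [avg, sum_sub_distrib, smul_sub]).limUnder_eq

lemma mean_sum {ι : Type*} (s : Finset ι) {a : ι → ℤ → F} {C : ι → ℝ}
    (h : ∀ i m, ‖a i m‖ ≤ C i) : mean (fun m => ∑ i ∈ s, a i m) = ∑ i ∈ s, mean (a i) :=
  ((tendsto_finsetSum s fun i _ => tendsto_mean (h i)).congr fun N => by
    simp only [avg, ← smul_sum, sum_comm (s := s)]).limUnder_eq

lemma mean_clm (h : ∀ m, ‖a m‖ ≤ C) (L : F →L[ℝ] G) :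
    mean (fun m => L (a m)) = L (mean a) :=
  (((L.continuous.tendsto _).comp (tendsto_mean h)).congr fun N => by
    simp [avg]).limUnder_eq

lemma mean_mono {a a' : ℤ → ℝ} (ha : ∀ m, ‖a m‖ ≤ C) (ha' : ∀ m, ‖a' m‖ ≤ C')
    (h : ∀ m, a m ≤ a' m) : mean a ≤ mean a' :=
  le_of_tendsto_of_tendsto' (tendsto_mean ha) (tendsto_mean ha') fun N => by
    simp only [avg, smul_eq_mul]
    gcongr with m
    exact h m

lemma norm_mean_le (h : ∀ m, ‖a m‖ ≤ C) : ‖mean a‖ ≤ C :=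
  le_of_tendsto' (tendsto_mean h).norm (norm_avg_le h)

lemma norm_mean_sq_le (h : ∀ m, ‖a m‖ ≤ C) : ‖mean a‖ ^ 2 ≤ mean fun m => ‖a m‖ ^ 2 := by
  have hsq : ∀ m, ‖‖a m‖ ^ 2‖ ≤ C ^ 2 := fun m => by
    rw [norm_pow, norm_norm]
    exact pow_le_pow_left₀ (norm_nonneg _) (h m) 2
  exact le_of_tendsto_of_tendsto' ((tendsto_mean h).norm.pow 2) (tendsto_mean hsq)
    (norm_avg_sq_le a)

lemma mean_shift (h : ∀ m, ‖a m‖ ≤ C) (k : ℤ) : mean (fun m => a (m + k)) = mean a := by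
  have := ((tendsto_avg_shift h k).mono_left Nat.hyperfilter_le_atTop).add (tendsto_mean h)
  simp only [sub_add_cancel, zero_add] at this
  exact this.limUnder_eq

end Mean

section Tent

/-- The tent function of height `r / 2` supported on `[0, r]`. -/
def tent (r s : ℝ) : ℝ := max 0 (min s (r - s))

lemma tent_nonneg (r s : ℝ) : 0 ≤ tent r s := le_max_left _ _

lemma tent_le_self (r : ℝ) {s : ℝ} (hs : 0 ≤ s) : tent r s ≤ s := max_le hs (min_le_left _ _)

lemma tent_le_one_sub {r s : ℝ} (hr : r ≤ 1) (hs : s ≤ 1) : tent r s ≤ 1 - s :=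
  max_le (by linarith) ((min_le_right _ _).trans (by linarith))

lemma mem_Ioo_of_tent_pos {r s : ℝ} (h : 0 < tent r s) : s ∈ Set.Ioo 0 r := by
  have := (lt_max_iff.mp h).resolve_left (lt_irrefl _)
  exact ⟨(lt_min_iff.mp this).1, sub_pos.mp (lt_min_iff.mp this).2⟩

lemma abs_tent_sub_le (r s s' : ℝ) : |tent r s - tent r s'| ≤ |s - s'| := by
  refine (abs_max_sub_max_le_max _ _ _ _).trans (max_le (by simp) ?_)
  refine (abs_min_sub_min_le_max _ _ _ _).trans (max_le le_rfl ?_)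
  rw [sub_sub_sub_cancel_left, abs_sub_comm]

lemma tent_fract_le_of_floor_lt {r u u' : ℝ} (hr : r ≤ 1) (h : ⌊u⌋ < ⌊u'⌋) :
    tent r (Int.fract u) ≤ u' - u ∧ tent r (Int.fract u') ≤ u' - u := by
  have floor_add_one_le : (⌊u⌋ : ℝ) + 1 ≤ ⌊u'⌋ := by exact_mod_cast h
  constructor
  · refine (tent_le_one_sub hr (Int.fract_lt_one _).le).trans ?_
    linarith [Int.floor_le u', Int.self_sub_floor u]
  · refine (tent_le_self r (Int.fract_nonneg _)).trans ?_
    linarith [Int.lt_floor_add_one u, Int.self_sub_floor u']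

end Tent

section Weight

/-- The weight of the `m`-th column of the smoothed strip. -/
def weight (r β w : ℝ) (m : ℤ) : ℝ := tent r (Int.fract (β * m - w))

/-- The lattice point of the `m`-th column on or just below the line `y = β x - w`. -/
def latticePoint (β w : ℝ) (m : ℤ) : ℤ × ℤ := (m, ⌊β * m - w⌋)

lemma weight_nonneg (r β w : ℝ) (m : ℤ) : 0 ≤ weight r β w m := tent_nonneg _ _

lemma weight_le_one (r β w : ℝ) (m : ℤ) : weight r β w m ≤ 1 :=
  (tent_le_self r (Int.fract_nonneg _)).trans (Int.fract_lt_one _).le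

lemma norm_weight_le_one (r β w : ℝ) (m : ℤ) : ‖weight r β w m‖ ≤ 1 := by
  rw [Real.norm_of_nonneg (weight_nonneg _ _ _ _)]
  exact weight_le_one r β w m

lemma latticePoint_mem_strip {r b β : ℝ} (hrb : r ≤ b) {m : ℤ}
    (h : 0 < weight r β (-(r / 2)) m) : latticePoint β (-(r / 2)) m ∈ strip β b := by
  obtain ⟨fract_pos, fract_lt⟩ := mem_Ioo_of_tent_pos h
  have := Int.self_sub_floor (β * m - -(r / 2))
  simp only [strip, latticePoint, Set.mem_ofPred_eq]
  constructor <;> linarith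

lemma exists_finset_strip_cover (β b₀ : ℝ) {b : ℝ} (hb : 0 < b) :
    ∃ F : Finset (ℤ × ℤ), ∀ g ∈ strip β b₀, ∃ g₀ ∈ F, g - g₀ ∈ strip β b := by
  set height : ℤ × ℤ → ℝ := fun g => g.2 - β * g.1 with height_def
  have bounded : TotallyBounded (height '' strip β b₀) := by
    refine (totallyBounded_Icc (-(b₀ / 2)) (b₀ / 2)).subset ?_
    rintro _ ⟨g, ⟨hg, hg'⟩, rfl⟩
    constructor <;> simp only [height_def] <;> linarith
  obtain ⟨t, ht, htf, hcov⟩ :=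
    Metric.finite_approx_of_totallyBounded bounded (b / 2) (by positivity)
  obtain ⟨F, -, hF, rfl⟩ := Set.exists_subset_image_finite_and.mp ⟨t, ht, htf, rfl⟩
  refine ⟨hF.toFinset, fun g hg => ?_⟩
  obtain ⟨_, ⟨g₀, hg₀, rfl⟩, near⟩ := Set.mem_iUnion₂.mp (hcov ⟨g, hg, rfl⟩)
  rw [Metric.mem_ball, Real.dist_eq, abs_lt] at near
  refine ⟨g₀, hF.mem_toFinset.2 hg₀, ?_⟩
  simp only [height_def] at near
  simp only [strip, Set.mem_ofPred_eq, Prod.fst_sub, Prod.snd_sub]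
  push_cast
  constructor <;> linarith [near.1, near.2]

lemma le_weight_of_sub_mem_strip {β r : ℝ} (hr : r ≤ 1) {p g : ℤ × ℤ}
    (h : p - g ∈ strip β (r / 2)) : r / 4 ≤ weight r β (-(r / 2)) (p.1 + -g.1) := by
  obtain ⟨lower, upper⟩ := h
  simp only [Prod.fst_sub, Prod.snd_sub] at lower upper
  have fract_eq : Int.fract (β * (p.1 + -g.1 : ℤ) - -(r / 2)) =
      β * (p.1 + -g.1 : ℤ) - -(r / 2) - (p.2 - g.2 : ℤ) := by
    rw [Int.fract_eq_iff]
    refine ⟨?_, ?_, p.2 - g.2, by ring⟩ <;> rw [← sub_eq_add_neg] <;> linarith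
  rw [weight, fract_eq, tent]
  refine le_max_of_le_right (le_min ?_ ?_) <;> rw [← sub_eq_add_neg] <;> linarith

lemma mean_weight_pos (β : ℝ) {r : ℝ} (hr : 0 < r) (hr1 : r ≤ 1) :
    0 < mean (weight r β (-(r / 2))) := by
  set ω := weight r β (-(r / 2))
  have hω : ∀ m, ‖ω m‖ ≤ 1 := norm_weight_le_one _ _ _
  obtain ⟨F, hF⟩ := exists_finset_strip_cover β 1 (b := r / 2) (by positivity)
  have le_sum : ∀ m : ℤ, r / 4 ≤ ∑ g ∈ F, ω (m + -g.1) := by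
    intro m
    have nearest_mem : (m, round (β * m)) ∈ strip β 1 := by
      have := abs_le.mp (abs_sub_round (β * m))
      simp only [strip, Set.mem_ofPred_eq]
      constructor <;> linarith
    obtain ⟨g, hg, hmem⟩ := hF _ nearest_mem
    exact (le_weight_of_sub_mem_strip hr1 hmem).trans
      (Finset.single_le_sum (f := fun g : ℤ × ℤ => ω (m + -g.1))
        (fun _ _ => weight_nonneg _ _ _ _) hg)
  have le_card_mul : r / 4 ≤ F.card * mean ω := by
    calc r / 4 = mean fun _ => r / 4 := (mean_const _).symm
      _ ≤ mean fun m => ∑ g ∈ F, ω (m + -g.1) :=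
          mean_mono (fun _ => le_rfl) (fun m => norm_sum_le_of_le F fun g _ => hω _) le_sum
      _ = ∑ _g ∈ F, mean ω := by
          rw [mean_sum F (a := fun g m => ω (m + -g.1)) fun _ _ => hω _]
          exact Finset.sum_congr rfl fun _ _ => mean_shift hω _
      _ = F.card * mean ω := by rw [Finset.sum_const, nsmul_eq_mul]
  by_contra! h
  nlinarith [F.card.cast_nonneg (α := ℝ)]

end Weight

section StripMean

variable {F G : Type*} [NormedAddCommGroup F] [NormedSpace ℝ F] [NormedAddCommGroup G]
  [NormedSpace ℝ G] {r β w : ℝ} {φ φ' : ℤ × ℤ → F} {C C' : ℝ}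

/-- The mean of a bounded function over the lattice points just below the line `y = β x - w`,
weighted by a tent function of their distance to the line; the smoothing makes it Lipschitz
in `w`. -/
def stripMean (r β w : ℝ) (φ : ℤ × ℤ → F) : F :=
  mean fun m => weight r β w m • φ (latticePoint β w m)

lemma norm_weight_smul_le {m : ℤ} {z : F} (h : ‖z‖ ≤ C) : ‖weight r β w m • z‖ ≤ C := by
  rw [norm_smul]
  exact (mul_le_of_le_one_left (norm_nonneg _) (norm_weight_le_one _ _ _ _)).trans h

lemma norm_weight_smul_sub_le (hr : r ≤ 1) (h : ∀ g, ‖φ g‖ ≤ C) (w w' : ℝ) (m : ℤ) :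
    ‖weight r β w m • φ (latticePoint β w m) - weight r β w' m • φ (latticePoint β w' m)‖ ≤
      2 * |w - w'| * C := by
  wlog hw : w' ≤ w generalizing w w'
  · rw [norm_sub_rev, abs_sub_comm]
    exact this w' w (le_of_not_ge hw)
  have : 0 ≤ C := (norm_nonneg _).trans (h 0)
  rw [abs_of_nonneg (sub_nonneg.2 hw)]
  rcases (Int.floor_le_floor (show β * m - w ≤ β * m - w' by linarith)).eq_or_lt with hf | hf
  · have hpt : latticePoint β w m = latticePoint β w' m := by simp [latticePoint, hf]
    rw [hpt, ← sub_smul, norm_smul, Real.norm_eq_abs]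
    refine mul_le_mul ?_ (h _) (norm_nonneg _) (by linarith)
    refine (abs_tent_sub_le _ _ _).trans ?_
    rw [Int.fract, Int.fract, hf, abs_le]
    constructor <;> linarith
  · obtain ⟨hle, hle'⟩ := tent_fract_le_of_floor_lt hr hf
    rw [sub_sub_sub_cancel_left] at hle hle'
    refine (norm_sub_le _ _).trans ?_
    simp only [norm_smul, Real.norm_of_nonneg (weight_nonneg _ _ _ _)]
    have bound := mul_le_mul hle (h (latticePoint β w m)) (norm_nonneg _) (by linarith)
    have bound' := mul_le_mul hle' (h (latticePoint β w' m)) (norm_nonneg _) (by linarith)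
    simp only [weight]
    linarith

variable [ProperSpace F]

lemma stripMean_add (h : ∀ g, ‖φ g‖ ≤ C) (h' : ∀ g, ‖φ' g‖ ≤ C') :
    stripMean r β w (fun g => φ g + φ' g) = stripMean r β w φ + stripMean r β w φ' := by
  simp only [stripMean, smul_add]
  exact mean_add (fun _ => norm_weight_smul_le (h _)) fun _ => norm_weight_smul_le (h' _)

lemma stripMean_sum {ι : Type*} (s : Finset ι) {φ : ι → ℤ × ℤ → F} {C : ι → ℝ}
    (h : ∀ i g, ‖φ i g‖ ≤ C i) :
    stripMean r β w (fun g => ∑ i ∈ s, φ i g) = ∑ i ∈ s, stripMean r β w (φ i) := by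
  simp only [stripMean, Finset.smul_sum]
  exact mean_sum s fun i _ => norm_weight_smul_le (h i _)

lemma stripMean_clm (h : ∀ g, ‖φ g‖ ≤ C) (L : F →L[ℝ] G) :
    stripMean r β w (fun g => L (φ g)) = L (stripMean r β w φ) := by
  simp only [stripMean, ← map_smul]
  exact mean_clm (fun _ => norm_weight_smul_le (h _)) L

lemma norm_stripMean_le (h : ∀ g, ‖φ g‖ ≤ C) : ‖stripMean r β w φ‖ ≤ C :=
  norm_mean_le fun _ => norm_weight_smul_le (h _)

lemma stripMean_mono {φ φ' : ℤ × ℤ → ℝ} (hφ : ∀ g, ‖φ g‖ ≤ C) (hφ' : ∀ g, ‖φ' g‖ ≤ C')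
    (h : ∀ g, φ g ≤ φ' g) : stripMean r β w φ ≤ stripMean r β w φ' :=
  mean_mono (fun _ => norm_weight_smul_le (hφ _)) (fun _ => norm_weight_smul_le (hφ' _))
    fun _ => mul_le_mul_of_nonneg_left (h _) (weight_nonneg _ _ _ _)

lemma stripMean_nonneg {φ : ℤ × ℤ → ℝ} (hφ : ∀ g, ‖φ g‖ ≤ C) (h : ∀ g, 0 ≤ φ g) :
    0 ≤ stripMean r β w φ := by
  have := stripMean_mono (r := r) (β := β) (w := w) (φ := 0) (C := 0) (by simp) hφ h
  simpa [stripMean, mean_const] using this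

lemma norm_stripMean_sq_le (h : ∀ g, ‖φ g‖ ≤ C) :
    ‖stripMean r β w φ‖ ^ 2 ≤ stripMean r β w fun g => ‖φ g‖ ^ 2 := by
  have hsq : ∀ g, ‖‖φ g‖ ^ 2‖ ≤ C ^ 2 := fun g => by
    rw [norm_pow, norm_norm]
    exact pow_le_pow_left₀ (norm_nonneg _) (h g) 2
  have weight_sq_mul_le : ∀ m, ‖weight r β w m • φ (latticePoint β w m)‖ ^ 2 ≤
      weight r β w m • ‖φ (latticePoint β w m)‖ ^ 2 := fun m => by
    rw [norm_smul, Real.norm_of_nonneg (weight_nonneg _ _ _ _), mul_pow, smul_eq_mul]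
    gcongr
    exact pow_le_of_le_one (weight_nonneg _ _ _ _) (weight_le_one _ _ _ _) two_ne_zero
  refine (norm_mean_sq_le fun m => norm_weight_smul_le (h _)).trans
    (mean_mono (C := C ^ 2) (fun m => ?_) (fun m => norm_weight_smul_le (hsq _)) weight_sq_mul_le)
  rw [norm_pow, norm_norm]
  exact pow_le_pow_left₀ (norm_nonneg _) (norm_weight_smul_le (h _)) 2

lemma stripMean_shift (h : ∀ g, ‖φ g‖ ≤ C) (g₀ : ℤ × ℤ) :
    stripMean r β w (fun g => φ (g - g₀)) = stripMean r β (w + g₀.2 - β * g₀.1) φ := by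
  have shift := mean_shift (a := fun m => weight r β (w + g₀.2 - β * g₀.1) m •
    φ (latticePoint β (w + g₀.2 - β * g₀.1) m)) (fun m => norm_weight_smul_le (h _)) (-g₀.1)
  rw [stripMean, stripMean, ← shift]
  congr 1
  funext m
  have line_shift :
      β * ((m + -g₀.1 : ℤ) : ℝ) - (w + g₀.2 - β * g₀.1) = β * m - w - (g₀.2 : ℤ) := by
    push_cast
    ring
  simp only [weight, latticePoint, line_shift, Int.fract_sub_intCast, Int.floor_sub_intCast]
  rfl

lemma norm_stripMean_sub_le (hr : r ≤ 1) (h : ∀ g, ‖φ g‖ ≤ C) (w w' : ℝ) :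
    ‖stripMean r β w φ - stripMean r β w' φ‖ ≤ 2 * |w - w'| * C := by
  rw [stripMean, stripMean, ← mean_sub (fun m => norm_weight_smul_le (h _))
    (fun m => norm_weight_smul_le (h _))]
  exact norm_mean_le (norm_weight_smul_sub_le hr h w w')

end StripMean

section StripFilter

variable {r β w : ℝ}

lemma norm_indicator_one_le {α : Type*} (A : Set α) (x : α) :
    ‖A.indicator (1 : α → ℝ) x‖ ≤ 1 := by
  simpa using norm_indicator_le_norm_self (s := A) (1 : α → ℝ) x

lemma stripMean_indicator_eq_zero_of_le {A : Set (ℤ × ℤ)} {φ : ℤ × ℤ → ℝ} {C : ℝ}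
    (hφ : ∀ g, ‖φ g‖ ≤ C) (hle : ∀ g, A.indicator 1 g ≤ φ g) (h : stripMean r β w φ = 0) :
    stripMean r β w (A.indicator (1 : ℤ × ℤ → ℝ)) = 0 :=
  le_antisymm ((stripMean_mono (norm_indicator_one_le A) hφ hle).trans_eq h)
    (stripMean_nonneg (norm_indicator_one_le A) (Set.indicator_nonneg fun _ _ => zero_le_one))

/-- The filter of the sets of lattice points whose complement is negligible for `stripMean`. -/
def stripFilter (r β w : ℝ) : Filter (ℤ × ℤ) :=
  Filter.comk (fun A => stripMean r β w (A.indicator (1 : ℤ × ℤ → ℝ)) = 0)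
    (by simp [stripMean, mean_const])
    (fun _ hA _ hBA => stripMean_indicator_eq_zero_of_le (norm_indicator_one_le _)
      (fun g => Set.indicator_le_indicator_of_subset hBA (fun _ => zero_le_one) g) hA)
    (fun A hA B hB => by
      refine stripMean_indicator_eq_zero_of_le (φ := fun g => A.indicator 1 g + B.indicator 1 g)
        (fun g => (norm_add_le _ _).trans (add_le_add (norm_indicator_one_le A g)
          (norm_indicator_one_le B g))) (fun g => ?_) ?_
      · by_cases hgA : g ∈ A <;> by_cases hgB : g ∈ B <;> simp [hgA, hgB]
      · rw [stripMean_add (norm_indicator_one_le A) (norm_indicator_one_le B), hA, hB, add_zero])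

lemma eventually_stripFilter {p : ℤ × ℤ → Prop} : (∀ᶠ g in stripFilter r β w, p g) ↔
    stripMean r β w ({g | ¬ p g}.indicator (1 : ℤ × ℤ → ℝ)) = 0 :=
  Filter.mem_comk

lemma neBot_stripFilter (β : ℝ) (hr : 0 < r) (hr1 : r ≤ 1) :
    (stripFilter r β (-(r / 2))).NeBot := by
  refine neBot_iff.2 fun hbot => (mean_weight_pos β hr hr1).ne' ?_
  have := eventually_stripFilter.1 (eventually_false_iff_eq_bot.2 hbot)
  simpa [stripMean] using this

lemma eventually_mem_strip_stripFilter {b : ℝ} (β : ℝ) (hrb : r ≤ b) :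
    ∀ᶠ g in stripFilter r β (-(r / 2)), g ∈ strip β b := by
  have zero_or_mem : ∀ m, weight r β (-(r / 2)) m = 0 ∨
      latticePoint β (-(r / 2)) m ∈ strip β b := fun m =>
    (weight_nonneg r β (-(r / 2)) m).eq_or_lt.imp Eq.symm (latticePoint_mem_strip hrb)
  have vanish : ∀ m, weight r β (-(r / 2)) m •
      {g | g ∉ strip β b}.indicator (1 : ℤ × ℤ → ℝ) (latticePoint β (-(r / 2)) m) = 0 := fun m =>
    (zero_or_mem m).elim (fun h => by rw [h, zero_smul]) fun h => by simp [h]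
  rw [eventually_stripFilter, stripMean, funext vanish, mean_const]

lemma eventually_lt_fst_stripFilter (M : ℤ) : ∀ᶠ g in stripFilter r β w, M < g.1 := by
  rw [eventually_stripFilter]
  refine mean_eq_of_tendsto (tendsto_const_nhds.congr' ?_)
  filter_upwards [eventually_gt_atTop M.toNat] with n hn
  have : M < n := Int.lt_of_toNat_lt hn
  simp [latticePoint, this]

lemma tendsto_stripFilter_zero {F : Type*} [SeminormedAddCommGroup F] {φ : ℤ × ℤ → F} {C : ℝ}
    (hφ : ∀ g, ‖φ g‖ ≤ C) (h : stripMean r β w (fun g => ‖φ g‖ ^ 2) = 0) :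
    Tendsto φ (stripFilter r β w) (𝓝 0) := by
  rw [Metric.tendsto_nhds]
  intro ε hε
  have hsq : ∀ g, ‖‖φ g‖ ^ 2‖ ≤ C ^ 2 := fun g => by
    rw [norm_pow, norm_norm]
    exact pow_le_pow_left₀ (norm_nonneg _) (hφ g) 2
  have scaled_eq_zero : stripMean r β w (fun g => (ε ^ 2)⁻¹ * ‖φ g‖ ^ 2) = 0 := by
    simpa [h] using stripMean_clm (r := r) (β := β) (w := w) hsq ((ε ^ 2)⁻¹ • .id ℝ ℝ)
  refine eventually_stripFilter.2 (stripMean_indicator_eq_zero_of_le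
    (C := (ε ^ 2)⁻¹ * C ^ 2) (fun g => ?_) (Set.indicator_le' (fun g hg => ?_) fun g _ => ?_)
    scaled_eq_zero)
  · rw [norm_mul, Real.norm_of_nonneg (by positivity)]
    gcongr
    exact hsq g
  · rw [Set.mem_ofPred_eq, dist_zero_right, not_lt] at hg
    rw [Pi.one_apply, inv_mul_eq_div, one_le_div (by positivity)]
    gcongr
  · positivity

end StripFilter

section CompactOperator

variable {𝕜 E F : Type*} [RCLike 𝕜] [NormedAddCommGroup E] [NormedAddCommGroup F]
  [NormedSpace 𝕜 F]

section HilbertSchmidt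

variable [InnerProductSpace 𝕜 E] {T : E →L[𝕜] F} {C : ℝ}

lemma exists_finiteDimensional_norm_map_sq_le
    (hT : ∀ (n : ℕ) (e : Fin n → E), Orthonormal 𝕜 e → ∑ i, ‖T (e i)‖ ^ 2 ≤ C)
    {ε : ℝ} (hε : 0 < ε) :
    ∃ V : Submodule 𝕜 E, FiniteDimensional 𝕜 V ∧ ∀ x ∈ Vᗮ, ‖T x‖ ^ 2 ≤ ε * ‖x‖ ^ 2 := by
  set sums : Set ℝ := {t | ∃ (n : ℕ) (e : Fin n → E), Orthonormal 𝕜 e ∧ ∑ i, ‖T (e i)‖ ^ 2 = t}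
  have bddAbove : BddAbove sums := ⟨C, by rintro _ ⟨n, e, he, rfl⟩; exact hT n e he⟩
  have nonempty : sums.Nonempty := ⟨_, 0, Fin.elim0, ⟨fun i => i.elim0, fun i => i.elim0⟩, rfl⟩
  obtain ⟨_, ⟨n, e, he, rfl⟩, hlt⟩ := exists_lt_of_lt_csSup nonempty (sub_lt_self (sSup sums) hε)
  refine ⟨.span 𝕜 (Set.range e), .span_of_finite 𝕜 (Set.finite_range e), fun x hx => ?_⟩
  rcases eq_or_ne x 0 with rfl | hx0
  · simp
  set u : E := (‖x‖⁻¹ : 𝕜) • x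
  have norm_u : ‖u‖ = 1 := norm_smul_inv_norm hx0
  have inner_u : ∀ i, ⟪u, e i⟫_𝕜 = 0 := fun i => by
    rw [inner_smul_left, Submodule.inner_left_of_mem_orthogonal
      (Submodule.subset_span (Set.mem_range_self i)) hx, mul_zero]
  have le_sSup := le_csSup bddAbove ⟨n + 1, _, orthonormal_vecCons_iff.2 ⟨norm_u, inner_u, he⟩, rfl⟩
  rw [Fin.sum_univ_succ] at le_sSup
  simp only [Matrix.cons_val_zero, Matrix.cons_val_succ] at le_sSup
  have norm_map_u : ‖T u‖ ^ 2 ≤ ε := by linarith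
  have norm_map_x : ‖T x‖ = ‖T u‖ * ‖x‖ := by
    rw [map_smul, norm_smul, norm_inv, RCLike.norm_ofReal, abs_norm]
    field_simp
  rw [norm_map_x, mul_pow]
  gcongr

lemma isCompactOperator_of_sum_norm_sq_le [CompleteSpace F]
    (hT : ∀ (n : ℕ) (e : Fin n → E), Orthonormal 𝕜 e → ∑ i, ‖T (e i)‖ ^ 2 ≤ C) :
    IsCompactOperator T := by
  refine isClosed_setOfPred_isCompactOperator.closure_subset
    (Metric.mem_closure_iff.2 fun ε hε => ?_)
  obtain ⟨V, _, hV⟩ := exists_finiteDimensional_norm_map_sq_le hT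
    (ε := (ε / 2) ^ 2) (by positivity)
  refine ⟨T ∘L V.starProjection, ?_, ?_⟩
  · have := FiniteDimensional.proper_rclike 𝕜 V
    exact (isCompactOperator_of_locallyCompactSpace_dom V.orthogonalProjectionOnto).clm_comp
      (T ∘L V.subtypeL)
  rw [dist_eq_norm]
  refine (ContinuousLinearMap.opNorm_le_bound _ (half_pos hε).le fun x => ?_).trans_lt
    (half_lt_self hε)
  rw [sub_apply, ContinuousLinearMap.comp_apply, ← map_sub]
  calc ‖T (x - V.starProjection x)‖ ≤ ε / 2 * ‖x - V.starProjection x‖ := by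
        refine le_of_sq_le_sq ?_ (by positivity)
        rw [mul_pow]
        exact hV _ (V.sub_starProjection_mem_orthogonal x)
    _ ≤ ε / 2 * ‖x‖ := by
        gcongr
        simpa using Vᗮ.norm_starProjection_apply_le x

end HilbertSchmidt

lemma totallyBounded_biUnion_image_closedBall [NormedSpace 𝕜 E] {K : Set (E →L[𝕜] F)}
    (hK : TotallyBounded K) (hcompact : ∀ T ∈ K, IsCompactOperator T) (R : ℝ) :
    TotallyBounded (⋃ T ∈ K, T '' Metric.closedBall 0 R) := by
  rw [Metric.totallyBounded_iff]
  intro ε hε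
  obtain ⟨K', hK', hfin, hcover⟩ :=
    Metric.finite_approx_of_totallyBounded hK (ε / 2 / (|R| + 1)) (by positivity)
  have images_totallyBounded : TotallyBounded (⋃ T ∈ K', T '' Metric.closedBall 0 R) :=
    (totallyBounded_biUnion hfin).2 fun T hT =>
      ((hcompact T (hK' hT)).isCompact_closure_image_closedBall _).totallyBounded.subset
        subset_closure
  obtain ⟨t, ht, hnet⟩ := Metric.totallyBounded_iff.1 images_totallyBounded (ε / 2) (half_pos hε)
  refine ⟨t, ht, ?_⟩
  simp only [Set.iUnion_subset_iff]
  rintro T hT _ ⟨x, hx, rfl⟩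
  obtain ⟨T', hT', hdist⟩ := Set.mem_iUnion₂.1 (hcover hT)
  obtain ⟨y, hy, hy'⟩ := Set.mem_iUnion₂.1 (hnet (Set.mem_biUnion hT' ⟨x, hx, rfl⟩))
  refine Set.mem_iUnion₂.2 ⟨y, hy, ?_⟩
  have dist_apply : dist (T x) (T' x) ≤ ε / 2 := by
    rw [dist_eq_norm, ← sub_apply]
    rw [Metric.mem_ball, dist_eq_norm] at hdist
    rw [mem_closedBall_zero_iff] at hx
    calc ‖(T - T') x‖ ≤ ‖T - T'‖ * ‖x‖ := ContinuousLinearMap.le_opNorm _ _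
      _ ≤ ε / 2 / (|R| + 1) * (|R| + 1) := by
          gcongr
          linarith [le_abs_self R]
      _ = ε / 2 := by field_simp
  rw [Metric.mem_ball] at hy' ⊢
  linarith [dist_triangle (T x) (T' x) y]

end CompactOperator

section StripOp

variable {𝕜 E : Type*} [RCLike 𝕜] [NormedAddCommGroup E] [InnerProductSpace 𝕜 E]
  (U : ℤ × ℤ → E →ₗᵢ[𝕜] E) (f : E)

lemma stripMean_const_mul {r β w C : ℝ} {φ : ℤ × ℤ → 𝕜} (hφ : ∀ g, ‖φ g‖ ≤ C) (c : 𝕜) :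
    stripMean r β w (fun g => c * φ g) = c * stripMean r β w φ :=
  stripMean_clm hφ (ContinuousLinearMap.mul ℝ 𝕜 c)

/-- The sesquilinear form of the rank one operator `x ↦ ⟪U g f, x⟫ U g f`. -/
def coeff (x y : E) (g : ℤ × ℤ) : 𝕜 := ⟪x, U g f⟫_𝕜 * ⟪U g f, y⟫_𝕜

lemma norm_inner_orbit_le (x : E) (g : ℤ × ℤ) : ‖⟪x, U g f⟫_𝕜‖ ≤ ‖x‖ * ‖f‖ := by
  simpa using norm_inner_le_norm (𝕜 := 𝕜) x (U g f)

lemma norm_inner_orbit_sq_le (x : E) (g : ℤ × ℤ) :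
    ‖‖⟪x, U g f⟫_𝕜‖ ^ 2‖ ≤ (‖x‖ * ‖f‖) ^ 2 := by
  rw [norm_pow, norm_norm]
  gcongr
  exact norm_inner_orbit_le U f x g

lemma norm_coeff_le_mul (x y : E) (g : ℤ × ℤ) :
    ‖coeff U f x y g‖ ≤ ‖f‖ * ‖y‖ * ‖⟪x, U g f⟫_𝕜‖ := by
  rw [coeff, norm_mul, mul_comm]
  gcongr
  simpa using norm_inner_le_norm (𝕜 := 𝕜) (U g f) y

lemma norm_coeff_le (x y : E) (g : ℤ × ℤ) : ‖coeff U f x y g‖ ≤ ‖f‖ ^ 2 * ‖x‖ * ‖y‖ :=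
  calc ‖coeff U f x y g‖ ≤ ‖f‖ * ‖y‖ * (‖x‖ * ‖f‖) :=
        (norm_coeff_le_mul U f x y g).trans (by gcongr; exact norm_inner_orbit_le U f x g)
    _ = ‖f‖ ^ 2 * ‖x‖ * ‖y‖ := by ring

lemma coeff_self (x : E) (g : ℤ × ℤ) : coeff U f x x g = ((‖⟪x, U g f⟫_𝕜‖ ^ 2 : ℝ) : 𝕜) := by
  rw [coeff, ← inner_conj_symm (U g f) x, RCLike.mul_conj, RCLike.ofReal_pow]

lemma coeff_map_map {U : ℤ × ℤ → E →ₗᵢ[𝕜] E} (hU : ∀ g g' x, U (g + g') x = U g (U g' x))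
    (g₀ : ℤ × ℤ) (x y : E) (g : ℤ × ℤ) :
    coeff U f (U g₀ x) (U g₀ y) g = coeff U f x y (g - g₀) := by
  have : U g f = U g₀ (U (g - g₀) f) := by rw [← hU, add_sub_cancel]
  rw [coeff, coeff, this, (U g₀).inner_map_map, (U g₀).inner_map_map]

/-- The mean of the forms `coeff` over a smoothed strip. -/
def stripForm (r β w : ℝ) : E →L⋆[𝕜] E →L[𝕜] 𝕜 :=
  LinearMap.mkContinuous₂
    (LinearMap.mk₂'ₛₗ (starRingEnd 𝕜) (RingHom.id 𝕜)
      (fun x y => stripMean r β w (coeff U f x y))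
      (fun x x' y => by
        rw [← stripMean_add (norm_coeff_le U f x y) (norm_coeff_le U f x' y)]
        congr 1 with g
        rw [coeff, inner_add_left, add_mul, coeff, coeff])
      (fun c x y => by
        rw [smul_eq_mul, ← stripMean_const_mul (norm_coeff_le U f x y)]
        congr 1 with g
        rw [coeff, inner_smul_left, mul_assoc, coeff])
      (fun x y y' => by
        rw [← stripMean_add (norm_coeff_le U f x y) (norm_coeff_le U f x y')]
        congr 1 with g
        rw [coeff, inner_add_right, mul_add, coeff, coeff])
      (fun c x y => by
        rw [RingHom.id_apply, smul_eq_mul, ← stripMean_const_mul (norm_coeff_le U f x y)]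
        congr 1 with g
        rw [coeff, inner_smul_right, mul_left_comm, coeff]))
    (‖f‖ ^ 2) (fun x y => norm_stripMean_le (norm_coeff_le U f x y))

variable [CompleteSpace E]

/-- The weak mean of the operators `x ↦ ⟪U g f, x⟫ U g f` over a smoothed strip. -/
def stripOp (r β w : ℝ) : E →L[𝕜] E :=
  InnerProductSpace.continuousLinearMapOfBilin (stripForm U f r β w)

lemma inner_stripOp (r β w : ℝ) (x y : E) :
    ⟪stripOp U f r β w x, y⟫_𝕜 = stripMean r β w (coeff U f x y) := by
  rw [stripOp, InnerProductSpace.continuousLinearMapOfBilin_apply]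
  rfl

lemma norm_stripOp_sq_le (r β w : ℝ) (x : E) :
    ‖stripOp U f r β w x‖ ^ 2 ≤ ‖f‖ ^ 2 * stripMean r β w fun g => ‖⟪x, U g f⟫_𝕜‖ ^ 2 := by
  set y := stripOp U f r β w x with hy
  set Q := stripMean r β w fun g => ‖⟪x, U g f⟫_𝕜‖ ^ 2
  have Q_nonneg : 0 ≤ Q := stripMean_nonneg (norm_inner_orbit_sq_le U f x) fun _ => by positivity
  have norm_sq_mul : (‖y‖ ^ 2) * ‖y‖ ^ 2 ≤ ‖f‖ ^ 2 * Q * ‖y‖ ^ 2 := by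
    calc ‖y‖ ^ 2 * ‖y‖ ^ 2 = ‖stripMean r β w (coeff U f x y)‖ ^ 2 := by
          rw [← inner_stripOp, ← hy, inner_self_eq_norm_sq_to_K]
          simp [sq]
      _ ≤ stripMean r β w fun g => ‖coeff U f x y g‖ ^ 2 :=
          norm_stripMean_sq_le (norm_coeff_le U f x y)
      _ ≤ stripMean r β w fun g => (‖f‖ * ‖y‖) ^ 2 * ‖⟪x, U g f⟫_𝕜‖ ^ 2 := by
          refine stripMean_mono (C := (‖f‖ ^ 2 * ‖x‖ * ‖y‖) ^ 2)
            (C' := (‖f‖ * ‖y‖) ^ 2 * (‖x‖ * ‖f‖) ^ 2) (fun g => ?_) (fun g => ?_) fun g => ?_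
          · rw [norm_pow, norm_norm]
            gcongr
            exact norm_coeff_le U f x y g
          · rw [norm_mul, Real.norm_of_nonneg (by positivity)]
            gcongr
            exact norm_inner_orbit_sq_le U f x g
          · rw [← mul_pow]
            gcongr
            exact norm_coeff_le_mul U f x y g
      _ = ‖f‖ ^ 2 * Q * ‖y‖ ^ 2 := by
          rw [stripMean_const_mul (norm_inner_orbit_sq_le U f x)]
          ring
  rcases (sq_nonneg ‖y‖).eq_or_lt with h0 | h0
  · rw [← h0]
    positivity
  · exact le_of_mul_le_mul_right norm_sq_mul h0

lemma sum_norm_stripOp_sq_le (r β w : ℝ) {n : ℕ} {e : Fin n → E} (he : Orthonormal 𝕜 e) :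
    ∑ i, ‖stripOp U f r β w (e i)‖ ^ 2 ≤ ‖f‖ ^ 2 * ‖f‖ ^ 2 := by
  have bessel : ∀ g, ‖∑ i, ‖⟪e i, U g f⟫_𝕜‖ ^ 2‖ ≤ ‖f‖ ^ 2 := fun g => by
    rw [Real.norm_of_nonneg (by positivity)]
    simpa using he.sum_inner_products_le (s := Finset.univ) (U g f)
  calc ∑ i, ‖stripOp U f r β w (e i)‖ ^ 2
      ≤ ∑ i, ‖f‖ ^ 2 * stripMean r β w fun g => ‖⟪e i, U g f⟫_𝕜‖ ^ 2 :=
        Finset.sum_le_sum fun i _ => norm_stripOp_sq_le U f r β w (e i)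
    _ = ‖f‖ ^ 2 * stripMean r β w fun g => ∑ i, ‖⟪e i, U g f⟫_𝕜‖ ^ 2 := by
        rw [← Finset.mul_sum, stripMean_sum _ fun i => norm_inner_orbit_sq_le U f (e i)]
    _ ≤ ‖f‖ ^ 2 * ‖f‖ ^ 2 := by
        gcongr
        exact (le_abs_self _).trans (norm_stripMean_le bessel)

lemma isCompactOperator_stripOp (r β w : ℝ) : IsCompactOperator (stripOp U f r β w) :=
  isCompactOperator_of_sum_norm_sq_le fun _ _ he => sum_norm_stripOp_sq_le U f r β w he

lemma norm_stripOp_sub_le {r : ℝ} (hr : r ≤ 1) (β w w' : ℝ) :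
    ‖stripOp U f r β w - stripOp U f r β w'‖ ≤ 2 * ‖f‖ ^ 2 * |w - w'| := by
  refine ContinuousLinearMap.opNorm_le_bound _ (by positivity) fun x => ?_
  set z := (stripOp U f r β w - stripOp U f r β w') x
  have norm_mul_norm : ‖z‖ * ‖z‖ ≤ 2 * ‖f‖ ^ 2 * |w - w'| * ‖x‖ * ‖z‖ := by
    calc ‖z‖ * ‖z‖ = ‖⟪z, z⟫_𝕜‖ := by simp [inner_self_eq_norm_sq_to_K, sq]
      _ = ‖stripMean r β w (coeff U f x z) - stripMean r β w' (coeff U f x z)‖ := by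
          rw [← inner_stripOp, ← inner_stripOp, ← inner_sub_left]
          rfl
      _ ≤ 2 * |w - w'| * (‖f‖ ^ 2 * ‖x‖ * ‖z‖) :=
          norm_stripMean_sub_le hr (norm_coeff_le U f x z) w w'
      _ = 2 * ‖f‖ ^ 2 * |w - w'| * ‖x‖ * ‖z‖ := by ring
  rcases (norm_nonneg z).eq_or_lt with h0 | h0
  · rw [← h0]
    positivity
  · exact le_of_mul_le_mul_right norm_mul_norm h0

lemma totallyBounded_stripOp_image_Icc {r : ℝ} (hr : r ≤ 1) (β s t : ℝ) :
    TotallyBounded (stripOp U f r β '' Set.Icc s t) := by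
  refine (totallyBounded_Icc s t).image (LipschitzWith.uniformContinuous
    (K := (2 * ‖f‖ ^ 2).toNNReal) (LipschitzWith.of_dist_le_mul fun w w' => ?_))
  rw [dist_eq_norm, Real.coe_toNNReal _ (by positivity)]
  exact norm_stripOp_sub_le U f hr β w w'

variable {U} (hU0 : ∀ x, U 0 x = x) (hU : ∀ g g' x, U (g + g') x = U g (U g' x))

include hU0 hU

lemma map_stripOp (r β w : ℝ) (g₀ : ℤ × ℤ) (x : E) :
    U g₀ (stripOp U f r β (w + g₀.2 - β * g₀.1) x) = stripOp U f r β w (U g₀ x) := by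
  refine ext_inner_right 𝕜 fun y => ?_
  obtain ⟨z, rfl⟩ : ∃ z, U g₀ z = y := ⟨U (-g₀) y, by rw [← hU, add_neg_cancel, hU0]⟩
  rw [(U g₀).inner_map_map, inner_stripOp, inner_stripOp, ← stripMean_shift (norm_coeff_le U f _ _)]
  congr 1 with g
  rw [coeff_map_map f hU]

lemma totallyBounded_orbit_stripOp {r : ℝ} (hr : r ≤ 1) (β b w : ℝ) (x : E) :
    TotallyBounded ((fun g => U g (stripOp U f r β w x)) '' strip β b) := by
  refine (totallyBounded_biUnion_image_closedBall
    (totallyBounded_stripOp_image_Icc U f hr β (w - b / 2) (w + b / 2)) ?_ ‖x‖).subset ?_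
  · rintro _ ⟨w', -, rfl⟩
    exact isCompactOperator_stripOp U f r β w'
  rintro _ ⟨g, ⟨hg, hg'⟩, rfl⟩
  have offset_mem : w - g.2 + β * g.1 ∈ Set.Icc (w - b / 2) (w + b / 2) := by
    constructor <;> linarith
  refine Set.mem_biUnion ⟨_, offset_mem, rfl⟩ ⟨U g x, by simp, ?_⟩
  rw [← map_stripOp f hU0 hU, show w - g.2 + β * g.1 + g.2 - β * g.1 = w by ring]

theorem stripMean_norm_inner_sq_eq_zero {r : ℝ} (hr : r ≤ 1) {β b : ℝ} (w : ℝ) {h : E}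
    (h_perp : ∀ x, TotallyBounded ((fun g => U g x) '' strip β b) → ⟪x, h⟫_𝕜 = 0) :
    stripMean r β w (fun g => ‖⟪h, U g f⟫_𝕜‖ ^ 2) = 0 := by
  have form_eq_zero := h_perp _ (totallyBounded_orbit_stripOp f hU0 hU hr β b w h)
  rw [inner_stripOp, funext (coeff_self U f h)] at form_eq_zero
  have := stripMean_clm (r := r) (β := β) (w := w) (norm_inner_orbit_sq_le U f h)
    (RCLike.ofRealCLM (K := 𝕜))
  exact RCLike.ofReal_eq_zero.1 (this.symm.trans form_eq_zero)

end StripOp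

lemma exists_finite_image_dist_lt {ι Y : Type*} [PseudoMetricSpace Y] {V : ι → Y} {s : Set ι}
    (hV : TotallyBounded (V '' s)) {ε : ℝ} (hε : 0 < ε) :
    ∃ γ : ι → ι, (γ '' s).Finite ∧ Set.MapsTo γ s s ∧ ∀ i ∈ s, dist (V i) (V (γ i)) < ε := by
  obtain ⟨t, ht, htf, hcov⟩ := Metric.finite_approx_of_totallyBounded hV ε hε
  obtain ⟨G, hGs, hG, rfl⟩ := Set.exists_subset_image_finite_and.mp ⟨t, ht, htf, rfl⟩
  have near : ∀ i, ∃ j, i ∈ s → j ∈ G ∧ dist (V i) (V j) < ε := fun i => by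
    by_cases hi : i ∈ s
    · obtain ⟨_, ⟨j, hj, rfl⟩, hij⟩ := Set.mem_iUnion₂.mp (hcov ⟨i, hi, rfl⟩)
      exact ⟨j, fun _ => ⟨hj, hij⟩⟩
    · exact ⟨i, fun h => absurd h hi⟩
  choose γ hγ using near
  exact ⟨γ, hG.subset (Set.image_subset_iff.mpr fun i hi => (hγ i hi).1),
    fun i hi => hGs (hγ i hi).1, fun i hi => (hγ i hi).2⟩

lemma totallyBounded_image_of_dist_lt {ι Y Z : Type*} [PseudoMetricSpace Y] [PseudoMetricSpace Z]
    {V : ι → Y} {W : ι → Z} {s : Set ι} (hV : TotallyBounded (V '' s))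
    (h : ∀ ε > 0, ∃ δ > 0, ∀ i ∈ s, ∀ j ∈ s, dist (V i) (V j) < δ → dist (W i) (W j) < ε) :
    TotallyBounded (W '' s) := by
  rw [Metric.totallyBounded_iff]
  intro ε hε
  obtain ⟨δ, hδ, hVW⟩ := h ε hε
  obtain ⟨γ, hfin, hmaps, hγ⟩ := exists_finite_image_dist_lt hV hδ
  refine ⟨W '' (γ '' s), hfin.image W, ?_⟩
  rintro _ ⟨i, hi, rfl⟩
  exact Set.mem_biUnion ⟨γ i, ⟨i, hi, rfl⟩, rfl⟩ (hVW i hi _ (hmaps hi) (hγ i hi))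

lemma totallyBounded_orbit_of_strip {Y : Type*} [UniformSpace Y] {U : ℤ × ℤ → Y → Y}
    (hU : ∀ g, UniformContinuous (U g)) (hadd : ∀ g g' y, U (g + g') y = U g (U g' y))
    {β b : ℝ} (hb : 0 < b) (b' : ℝ) {y : Y} (h : TotallyBounded ((fun g => U g y) '' strip β b)) :
    TotallyBounded ((fun g => U g y) '' strip β b') := by
  obtain ⟨F, hF⟩ := exists_finset_strip_cover β b' hb
  refine ((totallyBounded_biUnion F.finite_toSet).2 fun g₀ _ => h.image (hU g₀)).subset ?_
  rintro _ ⟨g, hg, rfl⟩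
  obtain ⟨g₀, hg₀, hmem⟩ := hF g hg
  refine Set.mem_biUnion hg₀ ⟨_, ⟨_, hmem, rfl⟩, ?_⟩
  simp only [← hadd, add_sub_cancel]

lemma symmDiff_superlevel_subset {X : Type*} (u v : X → ℝ) (t r : ℝ) :
    symmDiff {x | t < u x} {x | t < v x} ⊆
      u ⁻¹' Set.Ioc t r ∪ v ⁻¹' Set.Ioc t r ∪ {x | r - t ≤ |u x - v x|} := by
  intro x hx
  by_contra hnot
  simp only [Set.mem_union, Set.mem_preimage, Set.mem_Ioc, Set.mem_ofPred_eq, not_or, not_and,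
    not_le] at hnot
  obtain ⟨⟨hu, hv⟩, hdiff⟩ := hnot
  rw [abs_lt] at hdiff
  rcases hx with ⟨htu, htv⟩ | ⟨htv, htu⟩ <;> simp only [Set.mem_ofPred_eq, not_lt] at htu htv
  · linarith [hu htu]
  · linarith [hv htv]

section Measure

variable {X : Type*} [MeasurableSpace X]

lemma sq_mul_measureReal_le_norm_sq {μ : Measure X} {F : Type*} [NormedAddCommGroup F]
    (f : Lp F 2 μ) {δ : ℝ} (hδ : 0 < δ) : δ ^ 2 * μ.real {x | δ ≤ ‖f x‖} ≤ ‖f‖ ^ 2 := by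
  have chebyshev : ENNReal.ofReal δ ^ (2 : ENNReal).toReal *
      μ {x | ENNReal.ofReal δ ≤ ‖f x‖ₑ} ≤ ENNReal.ofReal ‖f‖ ^ (2 : ENNReal).toReal :=
    Lp.mul_meas_ge_le_pow_enorm' f two_ne_zero ENNReal.ofNat_ne_top (ENNReal.ofReal δ)
  have le_enorm_iff : ∀ x, ENNReal.ofReal δ ≤ ‖f x‖ₑ ↔ δ ≤ ‖f x‖ := fun x => by
    rw [← ofReal_norm, ENNReal.ofReal_le_ofReal_iff (norm_nonneg _)]
  simp only [le_enorm_iff] at chebyshev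
  simpa [ENNReal.toReal_ofReal hδ.le, ← ENNReal.toReal_rpow, measureReal_def] using
    ENNReal.toReal_mono (by finiteness) chebyshev

lemma exists_measureReal_preimage_Ioc_lt (μ : Measure X) [IsFiniteMeasure μ] {u : X → ℝ}
    (hu : Measurable u) (t : ℝ) {ε : ℝ} (hε : 0 < ε) :
    ∃ r > t, μ.real (u ⁻¹' Set.Ioc t r) < ε := by
  have iInter_eq_empty : ⋂ r > t, u ⁻¹' Set.Ioc t r = ∅ := by
    refine Set.eq_empty_of_forall_notMem fun x hx => ?_
    simp only [Set.mem_iInter, Set.mem_preimage, Set.mem_Ioc] at hx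
    obtain ⟨r, htr, hru⟩ := exists_between (hx (t + 1) (lt_add_one t)).1
    exact (hx r htr).2.not_gt hru
  have tendsto_measure := tendsto_measure_biInter_gt (μ := μ) (a := t)
    (s := fun r => u ⁻¹' Set.Ioc t r) (fun r _ => (hu measurableSet_Ioc).nullMeasurableSet)
    (fun r r' _ hrr' => Set.preimage_mono (Set.Ioc_subset_Ioc_right hrr'))
    ⟨t + 1, lt_add_one t, measure_ne_top μ _⟩
  rw [iInter_eq_empty, measure_empty] at tendsto_measure
  have tendsto_real := (ENNReal.tendsto_toReal ENNReal.zero_ne_top).comp tendsto_measure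
  obtain ⟨r, hlt, hr⟩ :=
    ((tendsto_real.eventually (gt_mem_nhds hε)).and self_mem_nhdsWithin).exists
  exact ⟨r, hr, hlt⟩

lemma exists_ae_eq_const_of_superlevel {μ : Measure X} {u : X → ℝ}
    (h : ∀ t, {x | t < u x} =ᵐ[μ] (∅ : Set X) ∨ {x | t < u x} =ᵐ[μ] (Set.univ : Set X)) :
    ∃ c, u =ᵐ[μ] fun _ => c := by
  have : HasCountableSeparatingOn ℝ (fun U => ∃ t, U = Set.Ioi t) Set.univ := by
    refine ⟨Set.range fun q : ℚ => Set.Ioi (q : ℝ), Set.countable_range _, ?_,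
      fun x _ y _ hxy => ?_⟩
    · rintro _ ⟨q, rfl⟩
      exact ⟨q, rfl⟩
    · refine eq_of_forall_rat_lt_iff_lt fun q => ?_
      exact hxy _ ⟨q, rfl⟩
  refine exists_eventuallyEq_const_of_forall_separating (fun U => ∃ t, U = Set.Ioi t) ?_
  rintro _ ⟨t, rfl⟩
  refine (h t).symm.imp (fun hae => ?_) fun hae => ?_
  · filter_upwards [hae.mem_iff] with x hx
    exact hx.mpr trivial
  · filter_upwards [hae.mem_iff] with x hx
    exact fun hlt => hx.mp hlt

variable (μ : Measure X) [IsFiniteMeasure μ]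

/-- The indicator function of a measurable set as an element of `L²(X, μ)`. -/
def indicatorL2 {B : Set X} (hB : MeasurableSet B) : Lp ℂ 2 μ :=
  indicatorConstLp 2 hB (measure_ne_top μ B) 1

variable {A B : Set X} (hA : MeasurableSet A) (hB : MeasurableSet B)

lemma inner_indicatorL2 : ⟪indicatorL2 μ hA, indicatorL2 μ hB⟫_ℂ = μ.real (A ∩ B) :=
  L2.inner_indicatorConstLp_one_indicatorConstLp_one hA hB

lemma dist_indicatorL2_sq :
    dist (indicatorL2 μ hA) (indicatorL2 μ hB) ^ 2 = μ.real (symmDiff A B) := by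
  rw [indicatorL2, indicatorL2, dist_indicatorConstLp_eq_norm,
    norm_indicatorConstLp two_ne_zero ENNReal.ofNat_ne_top]
  simp only [norm_one, one_mul, ENNReal.toReal_ofNat]
  rw [← Real.rpow_natCast, ← Real.rpow_mul measureReal_nonneg]
  norm_num

lemma eq_smul_indicatorL2_univ {f : Lp ℂ 2 μ} {c : ℂ} (hf : f =ᵐ[μ] fun _ => c) :
    f = c • indicatorL2 μ MeasurableSet.univ := by
  refine Lp.ext ?_
  filter_upwards [hf, Lp.coeFn_smul c (indicatorL2 μ (MeasurableSet.univ (α := X))),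
    indicatorConstLp_coeFn (p := 2) (hs := MeasurableSet.univ) (hμs := measure_ne_top μ _)
      (c := (1 : ℂ))] with x hfx hsmul hind
  rw [hfx, hsmul, Pi.smul_apply, indicatorL2, hind]
  simp

end Measure

section Koopman

variable {X : Type*} [MeasurableSpace X] [AddAction (ℤ × ℤ) X] [MeasurableConstVAdd (ℤ × ℤ) X]
  (μ : Measure X) [VAddInvariantMeasure (ℤ × ℤ) X μ]

lemma koopman_coeFn (g : ℤ × ℤ) (f : Lp ℂ 2 μ) : koopman μ g f =ᵐ[μ] fun x => f (g +ᵥ x) :=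
  Lp.coeFn_compMeasurePreserving f (measurePreserving_vadd g μ)

lemma koopman_zero (f : Lp ℂ 2 μ) : koopman μ 0 f = f := by
  refine Lp.ext ((koopman_coeFn μ 0 f).trans ?_)
  simp only [zero_vadd]
  rfl

lemma koopman_add (g g' : ℤ × ℤ) (f : Lp ℂ 2 μ) :
    koopman μ (g + g') f = koopman μ g (koopman μ g' f) := by
  refine Lp.ext ?_
  have koopman_g' := (measurePreserving_vadd g μ).quasiMeasurePreserving.ae_eq
    (koopman_coeFn μ g' f)
  filter_upwards [koopman_coeFn μ (g + g') f, koopman_coeFn μ g (koopman μ g' f), koopman_g']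
    with x hadd hg hg'
  rw [hadd, hg, add_comm g g', add_vadd]
  exact hg'.symm

lemma sq_mul_measureReal_le_dist_koopman_sq (f : Lp ℂ 2 μ) (g g' : ℤ × ℤ) {δ : ℝ} (hδ : 0 < δ) :
    δ ^ 2 * μ.real {x | δ ≤ ‖f (g +ᵥ x) - f (g' +ᵥ x)‖} ≤
      dist (koopman μ g f) (koopman μ g' f) ^ 2 := by
  have sub_ae_eq : ⇑(koopman μ g f - koopman μ g' f) =ᵐ[μ]
      fun x => f (g +ᵥ x) - f (g' +ᵥ x) :=
    (Lp.coeFn_sub _ _).trans ((koopman_coeFn μ g f).sub (koopman_coeFn μ g' f))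
  rw [dist_eq_norm]
  refine le_of_eq_of_le ?_ (sq_mul_measureReal_le_norm_sq _ hδ)
  congr 1
  refine measureReal_congr ?_
  filter_upwards [sub_ae_eq] with x hx
  exact congrArg (δ ≤ ‖·‖) hx.symm

variable [IsFiniteMeasure μ]

lemma koopman_indicatorL2 {B : Set X} (hB : MeasurableSet B) (g : ℤ × ℤ) :
    koopman μ g (indicatorL2 μ hB) = indicatorL2 μ (measurable_const_vadd g hB) := rfl

lemma mem_kroneckerAlgebra_iff {β b : ℝ} {B : Set X} : B ∈ kroneckerAlgebra μ β b ↔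
    ∃ hB : MeasurableSet B,
      TotallyBounded ((fun g => koopman μ g (indicatorL2 μ hB)) '' strip β b) :=
  exists_congr fun _ => ⟨fun h => h.totallyBounded.subset subset_closure,
    fun h => h.closure.isCompact_of_isClosed isClosed_closure⟩

lemma measureReal_symmDiff_superlevel_lt {f : Lp ℂ 2 μ} {π : ℂ → ℝ} (hπ : LipschitzWith 1 π)
    {t r ε : ℝ} (hr : t < r)
    (hlevel : μ.real ((fun x => π (f x)) ⁻¹' Set.Ioc t r) < ε) {g g' : ℤ × ℤ}
    (hdist : dist (koopman μ g f) (koopman μ g' f) ^ 2 < (r - t) ^ 2 * ε) :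
    μ.real (symmDiff {x | t < π (f (g +ᵥ x))} {x | t < π (f (g' +ᵥ x))}) < 3 * ε := by
  have hδ : 0 < r - t := sub_pos.2 hr
  have measurable_u : Measurable fun x => π (f x) :=
    hπ.continuous.measurable.comp (Lp.stronglyMeasurable f).measurable
  have level_lt : ∀ k : ℤ × ℤ, μ.real ((fun x => π (f (k +ᵥ x))) ⁻¹' Set.Ioc t r) < ε := fun k => by
    have := (measurePreserving_vadd k μ).measureReal_preimage
      (measurable_u (measurableSet_Ioc (a := t) (b := r))).nullMeasurableSet
    exact this.trans_lt hlevel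
  have deviation_lt : μ.real {x | r - t ≤ |π (f (g +ᵥ x)) - π (f (g' +ᵥ x))|} < ε := by
    have norm_lt : μ.real {x | r - t ≤ ‖f (g +ᵥ x) - f (g' +ᵥ x)‖} < ε :=
      lt_of_mul_lt_mul_left ((sq_mul_measureReal_le_dist_koopman_sq μ f g g' hδ).trans_lt hdist)
        (by positivity)
    refine (measureReal_mono fun x hx => ?_).trans_lt norm_lt
    have := hπ.dist_le_mul (f (g +ᵥ x)) (f (g' +ᵥ x))
    rw [NNReal.coe_one, one_mul, Real.dist_eq, dist_eq_norm] at this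
    exact le_trans hx this
  calc _ ≤ _ := measureReal_mono (symmDiff_superlevel_subset _ _ t r)
    _ ≤ _ := (measureReal_union_le _ _).trans (add_le_add_left (measureReal_union_le _ _) _)
    _ < 3 * ε := by linarith [level_lt g, level_lt g']

lemma superlevel_mem_kroneckerAlgebra {β b : ℝ} {f : Lp ℂ 2 μ}
    (hf : TotallyBounded ((fun g => koopman μ g f) '' strip β b)) {π : ℂ → ℝ}
    (hπ : LipschitzWith 1 π) (t : ℝ) : {x | t < π (f x)} ∈ kroneckerAlgebra μ β b := by
  have measurable_u : Measurable fun x => π (f x) :=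
    hπ.continuous.measurable.comp (Lp.stronglyMeasurable f).measurable
  have hB : MeasurableSet {x | t < π (f x)} := measurableSet_lt measurable_const measurable_u
  refine (mem_kroneckerAlgebra_iff μ).mpr ⟨hB, totallyBounded_image_of_dist_lt hf fun ε hε => ?_⟩
  obtain ⟨r, hr, hlevel⟩ :=
    exists_measureReal_preimage_Ioc_lt μ measurable_u t (ε := ε ^ 2 / 4) (by positivity)
  have : 0 < r - t := sub_pos.2 hr
  refine ⟨(r - t) * (ε / 2), by positivity, fun g _ g' _ hdist => ?_⟩
  have dist_sq_lt : dist (koopman μ g f) (koopman μ g' f) ^ 2 < (r - t) ^ 2 * (ε ^ 2 / 4) :=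
    (pow_lt_pow_left₀ hdist dist_nonneg two_ne_zero).trans_eq (by ring)
  refine lt_of_pow_lt_pow_left₀ 2 hε.le ?_
  rw [koopman_indicatorL2, koopman_indicatorL2, dist_indicatorL2_sq]
  refine (measureReal_symmDiff_superlevel_lt μ hπ hr hlevel dist_sq_lt).trans ?_
  linarith [sq_pos_of_pos hε]

lemma exists_ae_eq_const_of_totallyBounded {β b : ℝ} (hwm : IsWeakMixing μ β b) {f : Lp ℂ 2 μ}
    (hf : TotallyBounded ((fun g => koopman μ g f) '' strip β b)) :
    ∃ c : ℂ, f =ᵐ[μ] fun _ => c := by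
  have ae_const : ∀ π : ℂ → ℝ, LipschitzWith 1 π → ∃ c, (fun x => π (f x)) =ᵐ[μ] fun _ => c :=
    fun π hπ => exists_ae_eq_const_of_superlevel fun t =>
      hwm _ (superlevel_mem_kroneckerAlgebra μ hf hπ t)
  obtain ⟨c, hc⟩ := ae_const Complex.re (.of_dist_le_mul fun z z' => by
    simpa [Real.dist_eq, dist_eq_norm] using Complex.abs_re_le_norm (z - z'))
  obtain ⟨d, hd⟩ := ae_const Complex.im (.of_dist_le_mul fun z z' => by
    simpa [Real.dist_eq, dist_eq_norm] using Complex.abs_im_le_norm (z - z'))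
  refine ⟨⟨c, d⟩, ?_⟩
  filter_upwards [hc, hd] with x hre him
  exact Complex.ext hre him

end Koopman

section Mixing

variable {X : Type*} [MeasurableSpace X] [AddAction (ℤ × ℤ) X]

/-- Mixing of a `ℤ²`-action along a filter: preimages under `T^g` become independent of every
fixed event as `g` runs along `𝓕`. -/
def IsMixingAlong (μ : Measure X) (𝓕 : Filter (ℤ × ℤ)) : Prop :=
  ∀ ⦃A C : Set X⦄, MeasurableSet A → MeasurableSet C →
    Tendsto (fun g : ℤ × ℤ => μ.real (C ∩ (fun x => g +ᵥ x) ⁻¹' A)) 𝓕 (𝓝 (μ.real C * μ.real A))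

variable [MeasurableConstVAdd (ℤ × ℤ) X] (μ : Measure X) [IsProbabilityMeasure μ]
  [VAddInvariantMeasure (ℤ × ℤ) X μ]

lemma isMixingAlong_stripFilter {r β b : ℝ} (hr : r ≤ 1) (w : ℝ) (hwm : IsWeakMixing μ β b) :
    IsMixingAlong μ (stripFilter r β w) := by
  intro A C hA hC
  set h : Lp ℂ 2 μ := indicatorL2 μ hC - (μ.real C : ℂ) • indicatorL2 μ MeasurableSet.univ
  have perp : ∀ f, TotallyBounded ((fun g => koopman μ g f) '' strip β b) → ⟪f, h⟫_ℂ = 0 := by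
    intro f hf
    obtain ⟨c, hc⟩ := exists_ae_eq_const_of_totallyBounded μ hwm hf
    rw [eq_smul_indicatorL2_univ μ hc, inner_smul_left, inner_sub_right, inner_smul_right,
      inner_indicatorL2, inner_indicatorL2]
    simp
  have inner_eq : ∀ g, ⟪h, koopman μ g (indicatorL2 μ hA)⟫_ℂ =
      ((μ.real (C ∩ (fun x => g +ᵥ x) ⁻¹' A) - μ.real C * μ.real A : ℝ) : ℂ) := by
    intro g
    rw [koopman_indicatorL2, inner_sub_left, inner_smul_left, inner_indicatorL2,
      inner_indicatorL2, Set.univ_inter,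
      (measurePreserving_vadd g μ).measureReal_preimage hA.nullMeasurableSet]
    simp
  have inner_tendsto : Tendsto (fun g => ⟪h, koopman μ g (indicatorL2 μ hA)⟫_ℂ)
      (stripFilter r β w) (𝓝 0) :=
    tendsto_stripFilter_zero (norm_inner_orbit_le (koopman μ) _ h)
      (stripMean_norm_inner_sq_eq_zero _ (koopman_zero μ) (koopman_add μ) hr w perp)
  have re_tendsto := (Complex.continuous_re.tendsto _).comp inner_tendsto
  simp only [inner_eq, Function.comp_def, Complex.ofReal_re, Complex.zero_re] at re_tendsto
  simpa using re_tendsto.add_const (μ.real C * μ.real A)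

theorem exists_mixing_filter {β b₀ b : ℝ} (hb : 0 < b) (hwm : IsWeakMixing μ β b₀) :
    ∃ 𝓕 : Filter (ℤ × ℤ), 𝓕.NeBot ∧ (∀ᶠ g in 𝓕, g ∈ strip β b) ∧
      (∀ M : ℤ, ∀ᶠ g in 𝓕, M < g.1) ∧ IsMixingAlong μ 𝓕 :=
  ⟨stripFilter (min b 1) β (-(min b 1 / 2)),
    neBot_stripFilter β (lt_min hb one_pos) (min_le_right _ _),
    eventually_mem_strip_stripFilter β (min_le_left _ _), eventually_lt_fst_stripFilter,
    isMixingAlong_stripFilter μ (min_le_right _ _) _ hwm⟩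

end Mixing

namespace MeasurablePartition

variable {ι X : Type*} [MeasurableSpace X] (α : MeasurablePartition ι X)

lemma exists_mem_cell (x : X) : ∃ i, x ∈ α.cell i :=
  Set.mem_iUnion.mp (α.iUnion_cell ▸ Set.mem_univ x)

/-- The index of the cell containing a point. -/
def label (x : X) : ι := (α.exists_mem_cell x).choose

lemma mem_cell_label (x : X) : x ∈ α.cell (α.label x) := (α.exists_mem_cell x).choose_spec

lemma label_eq_iff {x : X} {i : ι} : α.label x = i ↔ x ∈ α.cell i := by
  refine ⟨fun h => h ▸ α.mem_cell_label x, fun h => ?_⟩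
  by_contra hne
  exact Set.disjoint_left.mp (α.disjoint_cell _ _ hne) (α.mem_cell_label x) h

lemma label_preimage (i : ι) : α.label ⁻¹' {i} = α.cell i :=
  Set.ext fun _ => α.label_eq_iff

lemma measurable_label [Countable ι] [MeasurableSpace ι] : Measurable α.label :=
  measurable_to_countable' fun i => α.label_preimage i ▸ α.measurableSet_cell i

lemma entropy_eq_entropy_label [Fintype ι] (μ : Measure X) :
    α.entropy μ = DirectionalWeakMixing.entropy μ α.label := by
  simp only [entropy, DirectionalWeakMixing.entropy, label_preimage]

end MeasurablePartition

lemma entropy_sequenceJoin {ι X : Type*} [Fintype ι] [MeasurableSpace X] [AddAction (ℤ × ℤ) X]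
    [MeasurableConstVAdd (ℤ × ℤ) X] (μ : Measure X) (α : MeasurablePartition ι X)
    (S : ℕ → ℤ × ℤ) (k : ℕ) :
    (sequenceJoin α S k).entropy μ = entropy μ (itinerary (fun j x => α.label (S j +ᵥ x)) k) := by
  refine Finset.sum_congr rfl fun v _ => congrArg (fun s => Real.negMulLog (μ.real s)) ?_
  ext x
  simp only [sequenceJoin, MeasurablePartition.join, MeasurablePartition.comap, Set.mem_iInter,
    Set.mem_preimage, Set.mem_singleton_iff, itinerary, funext_iff,
    MeasurablePartition.label_eq_iff]

section LabelL2

variable {X ι : Type*} [MeasurableSpace X] [Fintype ι] [DecidableEq ι] [MeasurableSpace ι]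
  [MeasurableSingletonClass ι] (μ : Measure X) [IsFiniteMeasure μ]

lemma memLp_pi_single {Y : X → ι} (hY : Measurable Y) :
    MemLp (fun x => (Pi.single (Y x) 1 : ι → ℝ)) 2 μ :=
  .of_bound
    ((measurable_of_finite fun i => (Pi.single i 1 : ι → ℝ)).comp hY).aestronglyMeasurable 1
    (ae_of_all _ fun x => by simp [Pi.norm_single])

/-- A finite-valued map regarded as an element of `L²`, its values being the standard basis
vectors. -/
def labelL2 {Y : X → ι} (hY : Measurable Y) : Lp (ι → ℝ) 2 μ := (memLp_pi_single μ hY).toLp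

lemma measureReal_ne_le_dist_labelL2_sq {Y Z : X → ι} (hY : Measurable Y) (hZ : Measurable Z) :
    μ.real {x | Y x ≠ Z x} ≤ dist (labelL2 μ hY) (labelL2 μ hZ) ^ 2 := by
  have chebyshev := sq_mul_measureReal_le_norm_sq (labelL2 μ hY - labelL2 μ hZ) one_pos
  rw [one_pow, one_mul, ← dist_eq_norm] at chebyshev
  refine (ENNReal.toReal_mono (measure_ne_top _ _) (measure_mono_ae ?_)).trans chebyshev
  filter_upwards [Lp.coeFn_sub (labelL2 μ hY) (labelL2 μ hZ), (memLp_pi_single μ hY).coeFn_toLp,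
    (memLp_pi_single μ hZ).coeFn_toLp] with x hsub hYx hZx (hne : Y x ≠ Z x)
  change 1 ≤ ‖(labelL2 μ hY - labelL2 μ hZ) x‖
  rw [hsub, Pi.sub_apply, labelL2, labelL2, hYx, hZx]
  have coord : ‖(Pi.single (Y x) 1 - Pi.single (Z x) 1 : ι → ℝ) (Y x)‖ = 1 := by simp [hne]
  exact coord.ge.trans (norm_le_pi_norm _ _)

end LabelL2

lemma exists_countable_dense_measurable (ι : Type*) {X : Type*} [MeasurableSpace X] [Finite ι]
    [MeasurableSpace ι] [MeasurableSingletonClass ι] (μ : Measure X) [IsFiniteMeasure μ]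
    [IsSeparable μ] :
    ∃ D : Set (X → ι), D.Countable ∧ (∀ Z ∈ D, Measurable Z) ∧
      ∀ Y : X → ι, Measurable Y → ∀ δ > 0, ∃ Z ∈ D, μ.real {x | Y x ≠ Z x} < δ := by
  classical
  have := Fintype.ofFinite ι
  have : Fact ((2 : ENNReal) ≠ ⊤) := ⟨ENNReal.ofNat_ne_top⟩
  let Φ : {Y : X → ι // Measurable Y} → Lp (ι → ℝ) 2 μ := fun Y => labelL2 μ Y.2
  obtain ⟨s, hs, hdense⟩ := TopologicalSpace.exists_countable_dense (Set.range Φ)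
  refine ⟨(fun f => (Set.rangeSplitting Φ f).1) '' s, hs.image _, ?_, fun Y hY δ hδ => ?_⟩
  · rintro _ ⟨f, -, rfl⟩
    exact (Set.rangeSplitting Φ f).2
  · obtain ⟨f, hf, hdist⟩ :=
      hdense.exists_dist_lt ⟨Φ ⟨Y, hY⟩, Set.mem_range_self _⟩ (Real.sqrt_pos.mpr hδ)
    refine ⟨_, ⟨f, hf, rfl⟩, ?_⟩
    have dist_lt : dist (labelL2 μ hY) (labelL2 μ (Set.rangeSplitting Φ f).2) < √δ := by
      change dist _ (Φ (Set.rangeSplitting Φ f)) < _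
      rwa [Set.apply_rangeSplitting Φ]
    exact (measureReal_ne_le_dist_labelL2_sq μ hY _).trans_lt
      ((Real.lt_sqrt dist_nonneg).mp dist_lt)

section Independence

lemma exists_seq_forall_prefix {α : Type*} {P : ∀ k : ℕ, (Fin k → α) → α → Prop}
    (h : ∀ k s, ∃ a, P k s a) : ∃ S : ℕ → α, ∀ k, P k (fun i => S i) (S k) := by
  choose next hnext using h
  let S : ℕ → α := fun k => Nat.strongRec (fun k prev => next k fun i => prev i i.2) k
  have S_eq : ∀ k, S k = next k fun i => S i := fun k => by
    simp only [S]
    rw [Nat.strongRec_eq]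
  exact ⟨S, fun k => by simpa only [← S_eq] using hnext k fun i => S i⟩

variable {X : Type*} [MeasurableSpace X] [AddAction (ℤ × ℤ) X]
  {μ : Measure X} [IsProbabilityMeasure μ]

lemma IsMixingAlong.tendsto_entropy {ι κ : Type*} [Fintype ι] [MeasurableSpace ι]
    [MeasurableSingletonClass ι] [Fintype κ] [MeasurableSpace κ] [MeasurableSingletonClass κ]
    {𝓕 : Filter (ℤ × ℤ)} (h𝓕 : IsMixingAlong μ 𝓕) {Y : X → ι} {W : X → κ} (hY : Measurable Y)
    (hW : Measurable W) :
    Tendsto (fun g : ℤ × ℤ => entropy μ (fun x => (Y (g +ᵥ x), W x))) 𝓕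
      (𝓝 (entropy μ Y + entropy μ W)) := by
  have sum_Y : ∑ i, μ.real (Y ⁻¹' {i}) = 1 := by
    simpa using sum_measureReal_inter_preimage μ hY Set.univ
  have sum_W : ∑ k, μ.real (W ⁻¹' {k}) = 1 := by
    simpa using sum_measureReal_inter_preimage μ hW Set.univ
  have entropy_add : entropy μ Y + entropy μ W =
      ∑ i, ∑ k, Real.negMulLog (μ.real (W ⁻¹' {k}) * μ.real (Y ⁻¹' {i})) := by
    simp only [Real.negMulLog_mul, Finset.sum_add_distrib, ← Finset.mul_sum, ← Finset.sum_mul,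
      sum_Y, sum_W, one_mul, entropy]
    exact add_comm _ _
  simp only [entropy_prodMk, entropy_add]
  refine tendsto_finsetSum _ fun i _ => tendsto_finsetSum _ fun k _ =>
    (Real.continuous_negMulLog.tendsto _).comp ?_
  simpa only [Set.inter_comm, Set.preimage_preimage] using
    h𝓕 (hY (measurableSet_singleton i)) (hW (measurableSet_singleton k))

theorem IsMixingAlong.exists_seq_asymptotically_independent [MeasurableConstVAdd (ℤ × ℤ) X]
    {𝓕 : Filter (ℤ × ℤ)} [𝓕.NeBot] (h𝓕 : IsMixingAlong μ 𝓕) {s : Set (ℤ × ℤ)}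
    (hs : ∀ᶠ g in 𝓕, g ∈ s) (hlt : ∀ M : ℤ, ∀ᶠ g in 𝓕, M < g.1) {J : Type*} [Countable J]
    {ι : J → Type*} [∀ j, Fintype (ι j)] [∀ j, MeasurableSpace (ι j)]
    [∀ j, MeasurableSingletonClass (ι j)] {Y : ∀ j, X → ι j} (hY : ∀ j, Measurable (Y j)) :
    ∃ S : ℕ → ℤ × ℤ, (∀ k, S k ∈ s) ∧ StrictMono (fun k => (S k).1) ∧
      ∀ j, Tendsto (fun k => entropy μ (itinerary (fun i x => Y j (S i +ᵥ x)) (k + 1)) -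
        entropy μ (itinerary (fun i x => Y j (S i +ᵥ x)) k)) atTop (𝓝 (entropy μ (Y j))) := by
  have := Encodable.ofCountable J
  obtain ⟨S, hS⟩ := exists_seq_forall_prefix (α := ℤ × ℤ) (P := fun k p g =>
    g ∈ s ∧ (∀ i, (p i).1 < g.1) ∧ ∀ j, Encodable.encode j < k →
      dist (entropy μ (fun x => (Y j (g +ᵥ x), fun i => Y j (p i +ᵥ x))))
        (entropy μ (Y j) + entropy μ (fun x i => Y j (p i +ᵥ x))) < 1 / ((k : ℝ) + 1)) <| by
    intro k p
    have finite_lt : {j : J | Encodable.encode j < k}.Finite :=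
      (Set.finite_lt_nat k).preimage Encodable.encode_injective.injOn
    refine (hs.and ((eventually_all.mpr fun i => hlt (p i).1).and
      ((eventually_all_finite finite_lt).mpr fun j _ => ?_))).exists
    exact (h𝓕.tendsto_entropy (hY j) (measurable_pi_lambda _ fun i =>
      (hY j).comp (measurable_const_vadd (p i)))).eventually
        (Metric.ball_mem_nhds _ Nat.one_div_pos_of_nat)
  refine ⟨S, fun k => (hS k).1,
    strictMono_nat_of_lt_succ fun k => (hS (k + 1)).2.1 (Fin.last k), fun j => ?_⟩
  refine tendsto_iff_dist_tendsto_zero.mpr (squeeze_zero' (.of_forall fun _ => dist_nonneg) ?_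
    tendsto_one_div_add_atTop_nhds_zero_nat)
  filter_upwards [eventually_gt_atTop (Encodable.encode j)] with k hk
  rw [entropy_itinerary_succ]
  refine le_of_eq_of_le ?_ ((hS k).2.2 j hk).le
  rw [Real.dist_eq, Real.dist_eq, sub_sub, add_comm (entropy μ (itinerary _ k))]
  rfl

end Independence

section FullEntropy

lemma tendsto_div_of_tendsto_sub {u : ℕ → ℝ} {c : ℝ}
    (h : Tendsto (fun k => u (k + 1) - u k) atTop (𝓝 c)) :
    Tendsto (fun k : ℕ => u k / k) atTop (𝓝 c) := by
  have := h.cesaro.add (tendsto_const_div_atTop_nhds_zero_nat (u 0))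
  simp only [Finset.sum_range_sub, add_zero] at this
  exact this.congr fun k => by ring

variable {X ι : Type*} [MeasurableSpace X] [Fintype ι] [MeasurableSpace ι]
  [MeasurableSingletonClass ι] {μ : Measure X} [IsProbabilityMeasure μ] {T : ℕ → X → X}

lemma entropy_itinerary_comp_div_le (hT : ∀ j, MeasurePreserving (T j) μ μ) {Y : X → ι}
    (hY : Measurable Y) (k : ℕ) :
    entropy μ (itinerary (fun j x => Y (T j x)) k) / k ≤ entropy μ Y := by
  refine div_le_of_le_mul₀ k.cast_nonneg (entropy_nonneg μ Y) ?_
  refine (entropy_itinerary_le_sum (fun j => hY.comp (hT j).measurable) k).trans_eq ?_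
  simp only [Function.comp_def, entropy_comp_measurePreserving hY (hT _), Finset.sum_const,
    Finset.card_range, nsmul_eq_mul, mul_comm]

lemma entropy_itinerary_comp_div_le_add_condEntropy (hT : ∀ j, MeasurePreserving (T j) μ μ)
    {Y Z : X → ι} (hY : Measurable Y) (hZ : Measurable Z) {k : ℕ} (hk : 0 < k) :
    entropy μ (itinerary (fun j x => Y (T j x)) k) / k ≤
      entropy μ (itinerary (fun j x => Z (T j x)) k) / k + condEntropy μ Y Z := by
  have hk' : (0 : ℝ) < k := Nat.cast_pos.mpr hk
  rw [div_le_iff₀ hk', add_mul, div_mul_cancel₀ _ hk'.ne']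
  refine (entropy_itinerary_le_add_sum_condEntropy μ (fun j => hY.comp (hT j).measurable)
    (fun j => hZ.comp (hT j).measurable) k).trans_eq ?_
  simp only [Function.comp_def, condEntropy_comp_measurePreserving hY hZ (hT _),
    Finset.sum_const, Finset.card_range, nsmul_eq_mul, mul_comm]

lemma tendsto_entropy_itinerary_comp_div_of_approx (hT : ∀ j, MeasurePreserving (T j) μ μ)
    {Y : X → ι} (hY : Measurable Y)
    (h : ∀ δ > 0, ∃ Z : X → ι, Measurable Z ∧ μ.real {x | Y x ≠ Z x} < δ ∧
      Tendsto (fun k : ℕ => entropy μ (itinerary (fun j x => Z (T j x)) k) / k) atTop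
        (𝓝 (entropy μ Z))) :
    Tendsto (fun k : ℕ => entropy μ (itinerary (fun j x => Y (T j x)) k) / k) atTop
      (𝓝 (entropy μ Y)) := by
  refine tendsto_order.mpr ⟨fun c hc => ?_, fun c hc =>
    .of_forall fun k => (entropy_itinerary_comp_div_le hT hY k).trans_lt hc⟩
  obtain ⟨δ, hδ, condEntropy_lt⟩ := exists_condEntropy_lt ι μ (half_pos (sub_pos.mpr hc))
  obtain ⟨Z, hZ, hYZ, hlim⟩ := h δ hδ
  have condEntropy_Y := condEntropy_lt Y Z hY hZ hYZ
  have condEntropy_Z := condEntropy_lt Z Y hZ hY (by simpa only [ne_comm] using hYZ)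
  have entropy_Y := entropy_le_add_condEntropy μ hY hZ
  filter_upwards [hlim.eventually (lt_mem_nhds (show c + condEntropy μ Z Y < _ by linarith)),
    eventually_gt_atTop 0] with k hlt hk
  linarith [entropy_itinerary_comp_div_le_add_condEntropy hT hZ hY hk]

end FullEntropy

section SequenceEntropy

variable {X : Type*} [MeasurableSpace X] [AddAction (ℤ × ℤ) X] [MeasurableConstVAdd (ℤ × ℤ) X]
  {μ : Measure X}

lemma sequenceEntropy_eq_of_tendsto {ι : Type*} [Fintype ι] {α : MeasurablePartition ι X}
    {S : ℕ → ℤ × ℤ} {c : ℝ} (h : Tendsto (fun k : ℕ =>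
      entropy μ (itinerary (fun j x => α.label (S j +ᵥ x)) k) / k) atTop (𝓝 c)) :
    sequenceEntropy μ α S = c := by
  simp only [sequenceEntropy, entropy_sequenceJoin]
  exact ((continuous_coe_real_ereal.tendsto c).comp h).limsup_eq

lemma sequenceEntropy_le_of_le_add_mul {ι : Type*} [Fintype ι] {α : MeasurablePartition ι X}
    {S : ℕ → ℤ × ℤ} {C c : ℝ}
    (h : ∀ k : ℕ, entropy μ (itinerary (fun j x => α.label (S j +ᵥ x)) k) ≤ C + k * c) :
    sequenceEntropy μ α S ≤ c := by
  have bound_tendsto : Tendsto (fun k : ℕ => ((C / k + c : ℝ) : EReal)) atTop (𝓝 (c : EReal)) :=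
    (continuous_coe_real_ereal.tendsto c).comp <| by
      simpa using (tendsto_const_div_atTop_nhds_zero_nat C).add_const c
  rw [← bound_tendsto.limsup_eq]
  simp only [sequenceEntropy, entropy_sequenceJoin]
  refine limsup_le_limsup ?_
  filter_upwards [eventually_gt_atTop 0] with k hk
  have hk' : (0 : ℝ) < k := Nat.cast_pos.mpr hk
  rw [EReal.coe_le_coe_iff, div_le_iff₀ hk', add_mul, div_mul_cancel₀ _ hk'.ne', mul_comm c]
  exact h k

variable [IsProbabilityMeasure μ] [VAddInvariantMeasure (ℤ × ℤ) X μ]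

theorem IsWeakMixing.exists_isStripSequence_sequenceEntropy_eq [IsSeparable μ] {β b₀ b : ℝ}
    (hb : 0 < b) (hwm : IsWeakMixing μ β b₀) :
    ∃ S : ℕ → ℤ × ℤ, IsStripSequence β b S ∧ ∀ (r : ℕ) (α : MeasurablePartition (Fin r) X),
      sequenceEntropy μ α S = ((α.entropy μ : ℝ) : EReal) := by
  obtain ⟨𝓕, _, hstrip, hlt, hmix⟩ := exists_mixing_filter μ hb hwm
  choose D hcount hmeas hdense using fun r : ℕ => exists_countable_dense_measurable (Fin r) μ
  have : ∀ r, Countable (D r) := fun r => (hcount r).to_subtype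
  obtain ⟨S, hS, hmono, hincr⟩ := hmix.exists_seq_asymptotically_independent hstrip hlt
    (J := Σ r, D r) (Y := fun Z => Z.2.1) fun Z => hmeas _ _ Z.2.2
  refine ⟨S, ⟨hS, .inl hmono⟩, fun r α => ?_⟩
  rw [α.entropy_eq_entropy_label]
  refine sequenceEntropy_eq_of_tendsto (tendsto_entropy_itinerary_comp_div_of_approx
    (fun j => measurePreserving_vadd (S j) μ) α.measurable_label fun δ hδ => ?_)
  obtain ⟨Z, hZ, hlt⟩ := hdense r α.label α.measurable_label δ hδ
  exact ⟨Z, hmeas r Z hZ, hlt, tendsto_div_of_tendsto_sub (hincr ⟨r, Z, hZ⟩)⟩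

end SequenceEntropy

section Converse

lemma exists_entropy_itinerary_comp_le {X ι J : Type*} [MeasurableSpace X] [Fintype ι]
    [MeasurableSpace ι] [MeasurableSingletonClass ι] (μ : Measure X) [IsFiniteMeasure μ]
    {V : J → X → ι} (hV : ∀ i, Measurable (V i)) {g : ℕ → J} (hg : (Set.range g).Finite) :
    ∃ C : ℝ, ∀ k, entropy μ (itinerary (fun j => V (g j)) k) ≤ C := by
  classical
  have := hg.fintype
  refine ⟨Fintype.card (Set.range g → ι), fun k => ?_⟩
  have hW : Measurable fun x (i : Set.range g) => V i x := measurable_pi_lambda _ fun i => hV i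
  exact (entropy_comp_le μ hW fun v (j : Fin k) => v ⟨g j, Set.mem_range_self _⟩).trans
    (entropy_le_card μ _)

variable {X : Type*} [MeasurableSpace X]

/-- The partition of a space into a measurable set and its complement. -/
def partitionOfSet {B : Set X} (hB : MeasurableSet B) : MeasurablePartition (Fin 2) X where
  cell := ![B, Bᶜ]
  measurableSet_cell i := by fin_cases i <;> simp [hB]
  disjoint_cell i j hij := by
    fin_cases i <;> fin_cases j <;> simp_all [disjoint_compl_right, disjoint_compl_left]
  iUnion_cell := by
    ext x
    simp [em]

lemma label_partitionOfSet_ne_iff {B : Set X} (hB : MeasurableSet B) {x y : X} :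
    (partitionOfSet hB).label x ≠ (partitionOfSet hB).label y ↔ ¬(x ∈ B ↔ y ∈ B) := by
  have label_eq_zero : ∀ x, (partitionOfSet hB).label x = 0 ↔ x ∈ B := fun x =>
    (partitionOfSet hB).label_eq_iff
  simp only [← label_eq_zero]
  omega

lemma ae_eq_empty_or_univ_of_entropy_partitionOfSet_le_zero {μ : Measure X}
    [IsProbabilityMeasure μ] {B : Set X} (hB : MeasurableSet B)
    (h : (partitionOfSet hB).entropy μ ≤ 0) : B =ᵐ[μ] (∅ : Set X) ∨ B =ᵐ[μ] Set.univ := by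
  have entropy_eq : (partitionOfSet hB).entropy μ = Real.binEntropy (μ.real B) := by
    rw [Real.binEntropy_eq_negMulLog_add_negMulLog_one_sub, ← probReal_compl_eq_one_sub hB]
    exact Fin.sum_univ_two _
  have binEntropy_eq_zero : Real.binEntropy (μ.real B) = 0 :=
    le_antisymm (entropy_eq ▸ h) (Real.binEntropy_nonneg measureReal_nonneg measureReal_le_one)
  refine (Real.binEntropy_eq_zero.mp binEntropy_eq_zero).imp (fun hzero => ?_) fun hone => ?_
  · exact ae_eq_empty.mpr ((measureReal_eq_zero_iff).mp hzero)
  · exact ae_eq_univ.mpr ((measureReal_eq_zero_iff).mp (by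
      rw [probReal_compl_eq_one_sub hB, hone, sub_self]))

variable [AddAction (ℤ × ℤ) X] [MeasurableConstVAdd (ℤ × ℤ) X] {μ : Measure X}
  [VAddInvariantMeasure (ℤ × ℤ) X μ]

lemma measureReal_label_partitionOfSet_vadd_ne [IsFiniteMeasure μ] {B : Set X}
    (hB : MeasurableSet B) (g g' : ℤ × ℤ) :
    μ.real {x | (partitionOfSet hB).label (g +ᵥ x) ≠ (partitionOfSet hB).label (g' +ᵥ x)} =
      dist (koopman μ g (indicatorL2 μ hB)) (koopman μ g' (indicatorL2 μ hB)) ^ 2 := by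
  rw [koopman_indicatorL2, koopman_indicatorL2, dist_indicatorL2_sq]
  congr 1
  ext x
  simp only [label_partitionOfSet_ne_iff, Set.mem_symmDiff, Set.mem_preimage, Set.mem_ofPred_eq]
  tauto

variable [IsProbabilityMeasure μ]

lemma sequenceEntropy_partitionOfSet_le_zero {s : Set (ℤ × ℤ)} {B : Set X} (hB : MeasurableSet B)
    (htb : TotallyBounded ((fun g => koopman μ g (indicatorL2 μ hB)) '' s)) {S : ℕ → ℤ × ℤ}
    (hS : ∀ i, S i ∈ s) : sequenceEntropy μ (partitionOfSet hB) S ≤ 0 := by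
  refine EReal.le_of_forall_lt_iff_le.mp fun ε hε => ?_
  obtain ⟨δ, hδ, condEntropy_lt⟩ := exists_condEntropy_lt (Fin 2) μ (EReal.coe_pos.mp hε)
  obtain ⟨γ, hfin, -, hγ⟩ := exists_finite_image_dist_lt htb (Real.sqrt_pos.mpr hδ)
  have measurable_translate : ∀ g : ℤ × ℤ, Measurable fun x =>
      (partitionOfSet hB).label (g +ᵥ x) := fun g =>
    (partitionOfSet hB).measurable_label.comp (measurable_const_vadd g)
  obtain ⟨C, hC⟩ := exists_entropy_itinerary_comp_le μ measurable_translate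
    (g := fun j => γ (S j)) (hfin.subset (Set.range_subset_iff.mpr fun j => ⟨S j, hS j, rfl⟩))
  refine sequenceEntropy_le_of_le_add_mul (C := C) fun k => ?_
  refine (entropy_itinerary_le_add_sum_condEntropy μ (fun j => measurable_translate (S j))
    (fun j => measurable_translate (γ (S j))) k).trans (add_le_add (hC k) ?_)
  refine (Finset.sum_le_card_nsmul _ _ ε fun j _ => ?_).trans_eq (by simp)
  refine (condEntropy_lt _ _ (measurable_translate _) (measurable_translate _) ?_).le
  rw [measureReal_label_partitionOfSet_vadd_ne]
  exact (Real.lt_sqrt dist_nonneg).mp (hγ _ (hS j))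

theorem isWeakMixing_of_sequenceEntropy_eq {β b₀ b : ℝ} (hb₀ : 0 < b₀) {S : ℕ → ℤ × ℤ}
    (hS : ∀ i, S i ∈ strip β b) (h : ∀ α : MeasurablePartition (Fin 2) X,
      sequenceEntropy μ α S = ((α.entropy μ : ℝ) : EReal)) :
    IsWeakMixing μ β b₀ := by
  intro B hBK
  obtain ⟨hB, orbit_b₀⟩ := (mem_kroneckerAlgebra_iff μ).mp hBK
  have orbit_b := totallyBounded_orbit_of_strip
    (fun g => (koopman μ g).isometry.uniformContinuous) (koopman_add μ) hb₀ b orbit_b₀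
  have := sequenceEntropy_partitionOfSet_le_zero hB orbit_b hS
  rw [h] at this
  exact ae_eq_empty_or_univ_of_entropy_partitionOfSet_le_zero hB (EReal.coe_nonpos.mp this)

end Converse

end DirectionalWeakMixing

end

open DirectionalWeakMixing in
theorem mainTheorem3_general {X : Type*} [MeasurableSpace X] [AddAction (ℤ × ℤ) X]
    [MeasurableConstVAdd (ℤ × ℤ) X] (μ : Measure X) [IsProbabilityMeasure μ] [IsSeparable μ]
    [VAddInvariantMeasure (ℤ × ℤ) X μ] (β b₀ : ℝ) (hb₀ : 0 < b₀) (b : ℝ) (hb : 0 < b) :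
    IsWeakMixing μ β b₀ ↔ ∃ S : ℕ → ℤ × ℤ, IsStripSequence β b S ∧
      ∀ (r : ℕ) (α : MeasurablePartition (Fin r) X),
        sequenceEntropy μ α S = ((α.entropy μ : ℝ) : EReal) :=
  ⟨fun hwm => hwm.exists_isStripSequence_sequenceEntropy_eq hb,
    fun ⟨_, hS, h⟩ => isWeakMixing_of_sequenceEntropy_eq hb₀ hS.1 (h 2)⟩

/-- For a `ℤ²`-action by homeomorphisms of a compact metric space with an invariant Borel
probability measure: weak mixing in direction `(1, β)` is equivalent to the existence of one
sequence in the strip of width `b` along which the sequence entropy of every finite measurable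
partition equals the entropy of the partition. The width `b₀` used in the definition of the
directional Kronecker algebra is arbitrary and unrelated to `b`. -/
theorem mainTheorem3 {X : Type*} [MetricSpace X] [CompactSpace X] [MeasurableSpace X]
    [BorelSpace X] [AddAction (ℤ × ℤ) X] [ContinuousConstVAdd (ℤ × ℤ) X]
    (μ : MeasureTheory.Measure X) [MeasureTheory.IsProbabilityMeasure μ]
    [MeasureTheory.VAddInvariantMeasure (ℤ × ℤ) X μ]
    (β : ℝ) (b₀ : ℝ) (hb₀ : 0 < b₀) (b : ℝ) (hb : 0 < b) :
    DirectionalWeakMixing.IsWeakMixing μ β b₀ ↔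
      ∃ S : ℕ → ℤ × ℤ, DirectionalWeakMixing.IsStripSequence β b S ∧
        ∀ (r : ℕ) (α : DirectionalWeakMixing.MeasurablePartition (Fin r) X),
          DirectionalWeakMixing.sequenceEntropy μ α S = ((α.entropy μ : ℝ) : EReal) :=
  mainTheorem3_general μ β b₀ hb₀ b hb
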